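/- Theorem 18 (Luo). Let $\Gamma$ be a compact connected tropical curve, i.e. the connected metric graph obtained from a finite graph (loops and multiple edges allowed) with positive real edge lengths by replacing each edge by an interval of the corresponding length. A divisor on $\Gamma$ is an element $D=\sum_x D(x)(x)$ of the free abelian group on the points of $\Gamma$; it is effective if all $D(x)\ge 0$, and its degree is $\sum_x D(x)$. A rational function on $\Gamma$ is a continuous real-valued function which is piecewise affine on every edge with finitely many pieces and integer slopes; $\operatorname{div}(f)=\sum_x \operatorname{ord}_x(f)(x)$, where $\operatorname{ord}_x(f)$ is the sum of the outgoing slopes of $f$ at $x$. Write $D\sim D'$ if $D=D'+\operatorname{div}(f)$ for some rational function $f$, let $|D|$ be the set of effective divisors linearly equivalent to $D$, and let the rank of $D$ be $$r(D)=\min\{\deg E : E\ge 0,\ |D-E|=\emptyset\}-1 .$$ A subset $A\subset\Gamma$ is called rank-determining if for every divisor $D$ on $\Gamma$ the rank $r(D)$ is equal to the maximum integer $r$ such that, for every effective divisor $E$ of degree $r$ with support contained in $A$, the divisor $D-E$ has non-negative rank. By cutting $\Gamma$ along $A$ one means forming the disjoint union of the closures in $\Gamma$ of the connected components of $\Gamma\setminus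 A$. The genus of each of these closures is its first Betti number as a topological space. Let $A\subset\Gamma$ be a subset. If cutting $\Gamma$ along $A$ results in a disjoint union of at least two pieces, and all these pieces have genus zero, then $A$ is rank-determining. -/

import Mathlib

/-! Finite graphs with edge lengths, their metric graphs (compact tropical curves), divisors,
rational functions, linear equivalence, rank, rank-determining sets, cuts along subsets. -/

universe u

/-- A finite weighted graph on vertex set `V` and edge set `E` (finiteness is imposed by `Fintype`
instances where needed). Loops and multiple edges are allowed. Every edge carries an auxiliary
orientation, from `src e` to `tgt e`, and a positive real length. -/
structure WeightedGraph (V E : Type u) where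
  src : E → V
  tgt : E → V
  len : E → ℝ
  len_pos : ∀ e, 0 < len e

namespace WeightedGraph

variable {V E : Type u}

/-- The points of the metric graph `Γ` of `G`: the vertices, and the points lying in the interior
of an edge `e`, parametrized by their distance `t ∈ (0, len e)` to `src e` along `e`. -/
inductive Point (G : WeightedGraph V E) : Type u
  | vertex (v : V) : Point G
  | inner (e : E) (t : Set.Ioo (0 : ℝ) (G.len e)) : Point G

open Classical in
/-- The parametrization by arc length of the closed edge `e`, from `[0, len e]` to `Γ`, extended to
`ℝ` by constants. -/
noncomputable def edge (G : WeightedGraph V E) (e : E) (t : ℝ) : G.Point :=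
  if h : t ∈ Set.Ioo (0 : ℝ) (G.len e) then Point.inner e ⟨t, h⟩
  else if t ≤ 0 then Point.vertex (G.src e) else Point.vertex (G.tgt e)

/-- The topology of `Γ`: the quotient topology of the gluing of the intervals `[0, len e]` along
the vertices. A set is open if and only if its preimage in every edge is open. -/
noncomputable instance instTopologicalSpacePoint (G : WeightedGraph V E) :
    TopologicalSpace G.Point :=
  ⨆ e : E, TopologicalSpace.coinduced (G.edge e) inferInstance

/-- A divisor: an element of the free abelian group on the points of `Γ`. The relation `0 ≤ D`
(all coefficients are nonnegative) says that `D` is effective, and `Finsupp.degree D` is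
the degree of `D`. -/
abbrev Divisor (G : WeightedGraph V E) : Type u := G.Point →₀ ℤ

/-- A rational function on `Γ`: a continuous function such that every edge can be subdivided by
finitely many points into segments on which the function is affine with integer slope. -/
structure IsRational (G : WeightedGraph V E) (f : G.Point → ℝ) : Prop where
  continuous : Continuous f
  piecewise_affine : ∀ e : E, ∃ S : Finset ℝ, ∀ a b : ℝ, 0 ≤ a → a ≤ b → b ≤ G.len e →
    (∀ s ∈ S, s ∉ Set.Ioo a b) →
      ∃ m : ℤ, ∀ t ∈ Set.Icc a b, f (G.edge e t) = f (G.edge e a) + m * (t - a)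

/-- The outgoing slope of `f` at the point of parameter `t < len e` of the edge `e`, along the
segment of `e` that starts at this point and goes towards `tgt e`. -/
noncomputable def slopeForward (G : WeightedGraph V E) (f : G.Point → ℝ) (e : E) (t : ℝ) : ℝ :=
  derivWithin (fun s => f (G.edge e s)) (Set.Ici t) t

/-- The outgoing slope of `f` at the point of parameter `t > 0` of the edge `e`, along the
segment of `e` that starts at this point and goes towards `src e`. -/
noncomputable def slopeBackward (G : WeightedGraph V E) (f : G.Point → ℝ) (e : E) (t : ℝ) : ℝ :=
  -derivWithin (fun s => f (G.edge e s)) (Set.Iic t) t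

open Classical in
/-- The order of `f` at a point: the sum of the outgoing slopes of `f` along all segments
emanating from that point (a loop contributes two segments at its vertex). -/
noncomputable def ord [Fintype E] (G : WeightedGraph V E) (f : G.Point → ℝ) : G.Point → ℝ
  | Point.vertex v =>
      (∑ e : E, if G.src e = v then G.slopeForward f e 0 else 0) +
        ∑ e : E, if G.tgt e = v then G.slopeBackward f e (G.len e) else 0
  | Point.inner e t => G.slopeForward f e t + G.slopeBackward f e t

/-- Linear equivalence: `D = D' + div f` for some rational function `f`, where the coefficient
of `div f` at `x` is the order of `f` at `x`. -/
def LinEquiv [Fintype E] (G : WeightedGraph V E) (D D' : G.Divisor) : Prop :=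
  ∃ f : G.Point → ℝ, G.IsRational f ∧ ∀ x : G.Point, (D x : ℝ) = D' x + G.ord f x

/-- The complete linear system `|D|`: the effective divisors linearly equivalent to `D`. -/
def linearSystem [Fintype E] (G : WeightedGraph V E) (D : G.Divisor) : Set G.Divisor :=
  {F | 0 ≤ F ∧ G.LinEquiv F D}

/-- The rank of `D`: one less than the minimal degree of an effective divisor `F` for which
`|D - F|` is empty. -/
noncomputable def rank [Fintype E] (G : WeightedGraph V E) (D : G.Divisor) : ℤ :=
  (sInf {n : ℕ | ∃ F : G.Divisor,
    0 ≤ F ∧ Finsupp.degree F = (n : ℤ) ∧ G.linearSystem (D - F) = ∅} : ℕ) - 1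

/-- `A` is rank-determining if the rank of every divisor `D` is the maximum of the integers `r`
such that `D - F` has nonnegative rank for all effective divisors `F` of degree `r` with
support in `A`. -/
def IsRankDetermining [Fintype E] (G : WeightedGraph V E) (A : Set G.Point) : Prop :=
  ∀ D : G.Divisor, IsGreatest
    {r : ℤ | ∀ F : G.Divisor, 0 ≤ F → Finsupp.degree F = r → (F.support : Set G.Point) ⊆ A →
      0 ≤ G.rank (D - F)}
    (G.rank D)

end WeightedGraph

/-- The connected components of the complement of `A`. Cutting the space along `A` gives the
disjoint union, over these components, of their closures in the whole space. -/
def cutComponents {X : Type u} [TopologicalSpace X] (A : Set X) : Set (Set X) :=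
  {C | ∃ x ∈ Aᶜ, C = connectedComponentIn Aᶜ x}

/-- The first Betti number of a topological space: the rank of its first singular homology group
with integer coefficients. For a compact tropical curve, this is the genus. -/
noncomputable def firstBetti (X : Type u) [TopologicalSpace X] : Cardinal.{u} :=
  Module.rank ℤ
    (((AlgebraicTopology.singularHomologyFunctor (ModuleCat.{u} ℤ) 1).obj
      (ModuleCat.of ℤ (ULift.{u} ℤ))).obj (TopCat.of X))

set_option autoImplicit false

/-! ### One-sided derivatives of functions that are affine next to a point. -/

section

open Set Filter Topology

/-! Exchanging the points of a divisor one at a time reduces the claim to this: if `|D - a|` is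
nonempty for all `a ∈ A`, then `|D - p|` is nonempty for every point `p`
(`isRankDetermining_of_forall`, `linearSystem_sub_nonempty`).

A section of an effective divisor `D` is a rational function `f` with `D + div f ≥ 0`. Sections have
integer slopes bounded by the degree of `D`, so the supremum of those vanishing at `p` is again a
section (`exists_maximal_section`). Adding its divisor to `D` gives an equivalent effective `D'`
that is reduced at `p`: all its sections vanishing at `p` are `≤ 0`.

Suppose `|D - p|` is empty. Then `D' p = 0`; let `U` be the component of `p` in the complement of
the support of `D'`. Sections are subharmonic off the support, so by the maximum principle they are
constant on `U` (`IsSection.eq_zero_on_component`). If some `a ∈ A` were in `U`, a member of `|D' -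
a|` would come from a section of order `0` at `a`, where `D' - a` has coefficient `-1`. Hence `U`
avoids `A` and lies in one component `C` of the complement of `A`.

If a point outside `U` had two directions into `U`, joining them inside `U` would give a loop in the
closure of `C`, and a circle-valued map that winds once along it shows that its homology class has
infinite order (`firstBetti_ne_zero_of_two_dirs`), against genus zero. So each boundary point of `U`
has a single direction into `U`, and it lies in the support of `D'`: one chip of each can be moved a
little into `U` (`exists_section_of_unique_dirs`). The function that does this, normalized at `p`,
is positive at the points of `A`, which contradicts reducedness. -/

theorem eventually_nhdsGT_zero_iff {p : ℝ → Prop} :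
    (∀ᶠ s in 𝓝[>] (0 : ℝ), p s) ↔ ∃ δ > 0, ∀ s, 0 < s → s < δ → p s := by
  rw [Filter.Eventually, mem_nhdsGT_iff_exists_Ioo_subset]
  constructor
  · rintro ⟨δ, hδ, h⟩
    exact ⟨δ, hδ, fun s h0 h1 => h ⟨h0, h1⟩⟩
  · rintro ⟨δ, hδ, h⟩
    exact ⟨δ, hδ, fun s hs => h s hs.1 hs.2⟩

theorem hasDerivWithinAt_Ici_of_eventually {φ : ℝ → ℝ} {t m : ℝ}
    (h : ∀ᶠ s in 𝓝[>] (0 : ℝ), φ (t + s) = φ t + m * s) : HasDerivWithinAt φ m (Ici t) t := by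
  obtain ⟨δ, hδ, h⟩ := eventually_nhdsGT_zero_iff.1 h
  have h1 : HasDerivWithinAt (fun s => φ t + m * (s - t)) m (Ici t) t := by
    simpa using (((hasDerivAt_id t).sub_const t).const_mul m).const_add (φ t) |>.hasDerivWithinAt
  refine h1.congr_of_eventuallyEq ?_ (by simp)
  filter_upwards [Ico_mem_nhdsGE (show t < t + δ by linarith)] with s hs
  rcases hs.1.eq_or_lt with rfl | h2
  · simp
  · have := h (s - t) (by linarith) (by linarith [hs.2])
    rw [← this]; congr 1; ring

theorem derivWithin_Ici_of_eventually {φ : ℝ → ℝ} {t m : ℝ}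
    (h : ∀ᶠ s in 𝓝[>] (0 : ℝ), φ (t + s) = φ t + m * s) : derivWithin φ (Ici t) t = m :=
  (hasDerivWithinAt_Ici_of_eventually h).derivWithin (uniqueDiffOn_Ici t t self_mem_Ici)

theorem derivWithin_Iic_of_eventually {φ : ℝ → ℝ} {t m : ℝ}
    (h : ∀ᶠ s in 𝓝[>] (0 : ℝ), φ (t - s) = φ t + m * s) : derivWithin φ (Iic t) t = -m := by
  obtain ⟨δ, hδ, h⟩ := eventually_nhdsGT_zero_iff.1 h
  have h1 : HasDerivWithinAt (fun s => φ t + (-m) * (s - t)) (-m) (Iic t) t := by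
    simpa using (((hasDerivAt_id t).sub_const t).const_mul (-m)).const_add (φ t)
      |>.hasDerivWithinAt
  refine (h1.congr_of_eventuallyEq ?_ (by simp)).derivWithin (uniqueDiffOn_Iic t t self_mem_Iic)
  filter_upwards [Ioc_mem_nhdsLE (show t - δ < t by linarith)] with s hs
  rcases hs.2.eq_or_lt with rfl | h2
  · simp
  · have := h (t - s) (by linarith) (by linarith [hs.1])
    rw [show φ s = φ (t - (t - s)) by congr 1; ring, this]; ring

/-! ### Tangent directions, rays, and the topology of the metric graph. -/

namespace WeightedGraph

variable {V E : Type u} (G : WeightedGraph V E)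

theorem edge_of_mem {e : E} {t : ℝ} (h : t ∈ Ioo (0 : ℝ) (G.len e)) :
    G.edge e t = Point.inner e ⟨t, h⟩ := dif_pos h

theorem edge_of_nonpos {e : E} {t : ℝ} (h : t ≤ 0) : G.edge e t = Point.vertex (G.src e) := by
  rw [edge, dif_neg (fun h' => by linarith [h'.1]), if_pos h]

theorem edge_of_len_le {e : E} {t : ℝ} (h : G.len e ≤ t) :
    G.edge e t = Point.vertex (G.tgt e) := by
  have := G.len_pos e
  rw [edge, dif_neg (fun h' => by linarith [h'.2]), if_neg (by linarith)]

theorem isOpen_iff {U : Set G.Point} : IsOpen U ↔ ∀ e, IsOpen (G.edge e ⁻¹' U) := by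
  simp only [isOpen_iSup_iff, isOpen_coinduced]

theorem continuous_edge (e : E) : Continuous (G.edge e) :=
  continuous_def.2 fun _ hU => G.isOpen_iff.1 hU e

variable {G} in
theorem continuous_iff {X : Type*} [TopologicalSpace X] {f : G.Point → X} :
    Continuous f ↔ ∀ e, Continuous fun t => f (G.edge e t) :=
  ⟨fun h e => h.comp (G.continuous_edge e), fun h => continuous_def.2 fun _ hU =>
    G.isOpen_iff.2 fun e => hU.preimage (h e)⟩

/-- The initial vertex of a directed edge; `true` stands for the direction from `src` to `tgt`. -/
def dirVertex (d : E × Bool) : V := if d.2 then G.src d.1 else G.tgt d.1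

/-- The tangent directions at a point. -/
def IsDir : G.Point → E × Bool → Prop
  | Point.vertex v, d => G.dirVertex d = v
  | Point.inner e _, d => d.1 = e

open Classical in
/-- The finite set of tangent directions at a point. -/
noncomputable def dirs [Fintype E] (x : G.Point) : Finset (E × Bool) :=
  Finset.univ.filter (G.IsDir x)

/-- The parameter of a point on the edge of a tangent direction. -/
noncomputable def start : G.Point → E × Bool → ℝ
  | Point.vertex _, d => if d.2 then 0 else G.len d.1
  | Point.inner _ t, _ => t

/-- The sign with which a direction changes the parameter of its edge. -/
def dirSign (b : Bool) : ℝ := if b then 1 else -1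

/-- The segment that leaves `x` in the direction `d`, parametrized by arc length. -/
noncomputable def ray (x : G.Point) (d : E × Bool) (s : ℝ) : G.Point :=
  G.edge d.1 (G.start x d + dirSign d.2 * s)

@[simp] theorem mem_dirs [Fintype E] {x : G.Point} {d : E × Bool} :
    d ∈ G.dirs x ↔ G.IsDir x d := by
  simp [dirs]

theorem continuous_ray (x : G.Point) (d : E × Bool) : Continuous (G.ray x d) :=
  (G.continuous_edge d.1).comp (by fun_prop)

variable {G}

theorem IsDir.ray_zero {x : G.Point} {d : E × Bool} (h : G.IsDir x d) : G.ray x d 0 = x := by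
  obtain ⟨e, b⟩ := d
  cases x with
  | vertex v =>
    cases b with
    | true => simpa [ray, start, edge_of_nonpos, IsDir, dirVertex] using h
    | false => simpa [ray, start, edge_of_len_le, IsDir, dirVertex] using h
  | inner e' t =>
    simp only [IsDir] at h
    subst h
    simp [ray, start, G.edge_of_mem t.2]

theorem IsDir.eventually_mem_Ioo {x : G.Point} {d : E × Bool} (h : G.IsDir x d) :
    ∀ᶠ s in 𝓝[>] (0 : ℝ), G.start x d + dirSign d.2 * s ∈ Ioo 0 (G.len d.1) := by
  obtain ⟨e, b⟩ := d
  have hl := G.len_pos e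
  rw [eventually_nhdsGT_zero_iff]
  cases x with
  | vertex v =>
    refine ⟨G.len e, hl, fun s h0 h1 => ?_⟩
    cases b <;> simp [start, dirSign] <;> constructor <;> linarith
  | inner e' t =>
    simp only [IsDir] at h
    subst h
    refine ⟨min t (G.len e - t), lt_min t.2.1 (by linarith [t.2.2]), fun s h0 h1 => ?_⟩
    have := lt_min_iff.1 h1
    cases b <;> simp [start, dirSign] <;> constructor <;> linarith [t.2.1, t.2.2]

theorem isDir_true {e : E} {t : ℝ} (h0 : 0 ≤ t) (h1 : t < G.len e) :
    G.IsDir (G.edge e t) (e, true) ∧ ∀ s, G.ray (G.edge e t) (e, true) s = G.edge e (t + s) := by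
  rcases h0.eq_or_lt with rfl | h0
  · simp [edge_of_nonpos, IsDir, dirVertex, ray, start, dirSign]
  · simp [edge_of_mem G ⟨h0, h1⟩, IsDir, ray, start, dirSign]

theorem isDir_false {e : E} {t : ℝ} (h0 : 0 < t) (h1 : t ≤ G.len e) :
    G.IsDir (G.edge e t) (e, false) ∧
      ∀ s, G.ray (G.edge e t) (e, false) s = G.edge e (t - s) := by
  rcases h1.eq_or_lt with rfl | h1
  · simp [edge_of_len_le, IsDir, dirVertex, ray, start, dirSign, sub_eq_add_neg]
  · simp [edge_of_mem G ⟨h0, h1⟩, IsDir, ray, start, dirSign, sub_eq_add_neg]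

/-- A neighbourhood of `t` in `[0, len e]` is covered by the rays of `e` that leave `edge e t`;
beyond the ends of the interval `edge e` is constant, so only `h0` is needed there. This turns local
statements on the graph into statements about rays. -/
theorem eventually_edge {P : G.Point → Prop} {e : E} {t : ℝ} (h0 : P (G.edge e t))
    (h : ∀ d, G.IsDir (G.edge e t) d → ∀ᶠ s in 𝓝[>] (0 : ℝ), P (G.ray (G.edge e t) d s)) :
    ∀ᶠ u in 𝓝 t, P (G.edge e u) := by
  have right : ∃ δ > 0, ∀ s, 0 < s → s < δ → P (G.edge e (t + s)) := by
    rcases lt_or_ge t 0 with ht | ht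
    · refine ⟨-t, by linarith, fun s _ hs => ?_⟩
      rwa [edge_of_nonpos G (by linarith), ← edge_of_nonpos G ht.le]
    rcases lt_or_ge t (G.len e) with ht' | ht'
    · obtain ⟨hd, hr⟩ := isDir_true ht ht'
      have := h _ hd
      simp only [hr] at this
      exact eventually_nhdsGT_zero_iff.1 this
    · refine ⟨1, one_pos, fun s hs _ => ?_⟩
      rwa [edge_of_len_le G (by linarith), ← edge_of_len_le G ht']
  have left : ∃ δ > 0, ∀ s, 0 < s → s < δ → P (G.edge e (t - s)) := by
    rcases lt_or_ge (G.len e) t with ht | ht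
    · refine ⟨t - G.len e, by linarith, fun s _ hs => ?_⟩
      rwa [edge_of_len_le G (by linarith), ← edge_of_len_le G ht.le]
    rcases lt_or_ge 0 t with ht' | ht'
    · obtain ⟨hd, hr⟩ := isDir_false ht' ht
      have := h _ hd
      simp only [hr] at this
      exact eventually_nhdsGT_zero_iff.1 this
    · refine ⟨1, one_pos, fun s hs _ => ?_⟩
      rwa [edge_of_nonpos G (by linarith), ← edge_of_nonpos G ht']
  obtain ⟨δ₁, hδ₁, h₁⟩ := right
  obtain ⟨δ₂, hδ₂, h₂⟩ := left
  filter_upwards [Ioo_mem_nhds (show t - δ₂ < t by linarith) (show t < t + δ₁ by linarith)]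
    with u hu
  rcases lt_trichotomy u t with h | rfl | h
  · simpa using h₂ (t - u) (by linarith) (by linarith [hu.1])
  · exact h0
  · simpa using h₁ (u - t) (by linarith) (by linarith [hu.2])

theorem isOpen_of_eventually_ray {U : Set G.Point}
    (h : ∀ x ∈ U, ∀ d, G.IsDir x d → ∀ᶠ s in 𝓝[>] (0 : ℝ), G.ray x d s ∈ U) : IsOpen U := by
  refine G.isOpen_iff.2 fun e => isOpen_iff_mem_nhds.2 fun t ht => ?_
  exact eventually_edge (P := (· ∈ U)) ht (h _ ht)

theorem IsDir.eventually_mem {U : Set G.Point} (hU : IsOpen U) {x : G.Point} (hx : x ∈ U)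
    {d : E × Bool} (hd : G.IsDir x d) : ∀ᶠ s in 𝓝[>] (0 : ℝ), G.ray x d s ∈ U := by
  have := (G.continuous_ray x d).continuousAt.preimage_mem_nhds (x := 0) (t := U)
    (hU.mem_nhds (by rwa [hd.ray_zero]))
  exact nhdsWithin_le_nhds this

theorem continuous_of_tendsto_ray {X : Type*} [TopologicalSpace X] {f : G.Point → X}
    (h : ∀ x d, G.IsDir x d → Tendsto (fun s => f (G.ray x d s)) (𝓝[>] (0 : ℝ)) (𝓝 (f x))) :
    Continuous f := by
  refine continuous_iff.2 fun e => continuous_iff_continuousAt.2 fun t => ?_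
  intro N hN
  exact eventually_edge (P := fun x => f x ∈ N) (mem_of_mem_nhds hN) fun d hd => h _ d hd hN

/-- Just after its start a ray runs injectively through the interior of one edge, so it avoids any
given point, its own origin included. -/
theorem IsDir.eventually_ne {y : G.Point} {d : E × Bool} (hd : G.IsDir y d) (x : G.Point) :
    ∀ᶠ s in 𝓝[>] (0 : ℝ), G.ray y d s ≠ x := by
  have hst := hd.eventually_mem_Ioo
  cases x with
  | vertex v =>
    filter_upwards [hst] with s hs
    simp [ray, edge_of_mem G hs]
  | inner e t =>
    have hne : ∀ᶠ s in 𝓝[>] (0 : ℝ), G.start y d + dirSign d.2 * s ≠ t := by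
      by_cases h0 : G.start y d = t
      · filter_upwards [self_mem_nhdsWithin] with s hs h1
        have hs : 0 < s := hs
        unfold dirSign at h1
        split_ifs at h1 <;> linarith
      · have : Tendsto (fun s : ℝ => G.start y d + dirSign d.2 * s) (𝓝 0)
            (𝓝 (G.start y d + dirSign d.2 * 0)) := Continuous.tendsto (by fun_prop) 0
        rw [mul_zero, add_zero] at this
        exact nhdsWithin_le_nhds (this.eventually_ne h0)
    filter_upwards [hst, hne] with s hs hs'
    simp only [ray, edge_of_mem G hs, ne_eq, Point.inner.injEq, not_and]
    rintro rfl h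
    exact hs' (congrArg Subtype.val (eq_of_heq h))

instance : T1Space G.Point where
  t1 x := by
    rw [← isOpen_compl_iff]
    exact isOpen_of_eventually_ray fun y _ d hd => hd.eventually_ne x

/-- Near `x` on the ray in direction `d`, both directions of the edge are directions along
the ray. -/
theorem isDir_ray {x : G.Point} {d : E × Bool} {s : ℝ}
    (h : G.start x d + dirSign d.2 * s ∈ Ioo 0 (G.len d.1)) :
    G.IsDir (G.ray x d s) d ∧ G.IsDir (G.ray x d s) (d.1, !d.2) ∧
      (∀ u, G.ray (G.ray x d s) d u = G.ray x d (s + u)) ∧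
      ∀ u, G.ray (G.ray x d s) (d.1, !d.2) u = G.ray x d (s - u) := by
  have hx : G.ray x d s = Point.inner d.1 ⟨_, h⟩ := edge_of_mem G h
  refine ⟨by rw [hx]; rfl, by rw [hx]; rfl, fun u => ?_, fun u => ?_⟩
  · rw [hx]
    simp only [ray, start]
    congr 1; ring
  · rw [hx]
    simp only [ray, start]
    congr 1
    cases d.2 <;> simp [dirSign] <;> ring

/-- Local path connectedness passes from `ℝ` to the quotient topology. It makes components of open
sets open, and connected open sets path connected. -/
instance : LocallyPathConnectedSpace G.Point := by
  refine locallyPathConnectedSpace_iff_isOpen_pathComponentIn.mpr fun y U hU =>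
    G.isOpen_iff.2 fun e => isOpen_iff_mem_nhds.2 fun t ht => ?_
  have ht' : t ∈ G.edge e ⁻¹' U := preimage_mono pathComponentIn_subset ht
  refine mem_nhds_iff.2 ⟨pathComponentIn (G.edge e ⁻¹' U) t, ?_,
    (hU.preimage (G.continuous_edge e)).pathComponentIn _, mem_pathComponentIn_self ht'⟩
  rw [← image_subset_iff, ← pathComponentIn_congr ht]
  exact ((isPathConnected_pathComponentIn ht').image (G.continuous_edge e)).subset_pathComponentIn
    ⟨t, mem_pathComponentIn_self ht', rfl⟩ <|
    (image_mono pathComponentIn_subset).trans <| U.image_preimage_subset _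


/-! ### Slopes along rays, and rational functions as locally affine functions. -/

/-- `f` is affine with slope `m` along an initial piece of the segment leaving `x` in
direction `d`. -/
def HasSlope (f : G.Point → ℝ) (x : G.Point) (d : E × Bool) (m : ℝ) : Prop :=
  ∀ᶠ s in 𝓝[>] (0 : ℝ), f (G.ray x d s) = f x + m * s

/-- `f` is affine with integer slopes near every point. -/
def IsLocAffine (f : G.Point → ℝ) : Prop :=
  ∀ x d, G.IsDir x d → ∃ m : ℤ, HasSlope f x d m

namespace HasSlope

variable {f g : G.Point → ℝ} {x : G.Point} {d : E × Bool} {m n : ℝ}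

theorem const (c : ℝ) : HasSlope (fun _ : G.Point => c) x d 0 :=
  Eventually.of_forall fun s => by simp

theorem add (hf : HasSlope f x d m) (hg : HasSlope g x d n) :
    HasSlope (fun y => f y + g y) x d (m + n) := by
  filter_upwards [hf, hg] with s h1 h2
  rw [h1, h2]; ring

theorem neg (hf : HasSlope f x d m) : HasSlope (fun y => -f y) x d (-m) := by
  filter_upwards [hf] with s h1
  rw [h1]; ring

theorem unique (hf : HasSlope f x d m) (hf' : HasSlope f x d n) : m = n := by
  obtain ⟨s, h1, h2, h3⟩ := (hf.and (hf'.and self_mem_nhdsWithin)).exists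
  have h3 : 0 < s := h3
  rw [h1] at h2
  have : (m - n) * s = 0 := by linarith
  rcases mul_eq_zero.1 this with h | h <;> linarith

theorem le_of_le (hf : HasSlope f x d m) (hg : HasSlope g x d n) (h0 : f x = g x)
    (h : ∃ᶠ s in 𝓝[>] (0 : ℝ), f (G.ray x d s) ≤ g (G.ray x d s)) : m ≤ n := by
  obtain ⟨s, h1, h2, h3, h4⟩ := (h.and_eventually (hf.and (hg.and self_mem_nhdsWithin))).exists
  have h4 : 0 < s := h4
  rw [h2, h3, h0] at h1
  exact le_of_mul_le_mul_right (by linarith) h4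

theorem tendsto (hf : HasSlope f x d m) :
    Tendsto (fun s => f (G.ray x d s)) (𝓝[>] (0 : ℝ)) (𝓝 (f x)) := by
  have h : Tendsto (fun s : ℝ => f x + m * s) (𝓝[>] 0) (𝓝 (f x + m * 0)) :=
    (Continuous.tendsto (by fun_prop) 0).mono_left nhdsWithin_le_nhds
  rw [mul_zero, add_zero] at h
  exact h.congr' (hf.mono fun s hs => hs.symm)

theorem congr (hf : HasSlope f x d m) (h0 : f x = g x)
    (h : ∀ᶠ s in 𝓝[>] (0 : ℝ), f (G.ray x d s) = g (G.ray x d s)) : HasSlope g x d m := by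
  filter_upwards [hf, h] with s h1 h2
  rw [← h2, h1, h0]

theorem max_of_lt (hf : HasSlope f x d m) (hg : HasSlope g x d n) (h : f x < g x) :
    HasSlope (fun y => max (f y) (g y)) x d n := by
  filter_upwards [hg, hf.tendsto.eventually_lt hg.tendsto h] with s h1 h2
  rw [max_eq_right h2.le, max_eq_right h.le, h1]

theorem max_of_eq (hf : HasSlope f x d m) (hg : HasSlope g x d n) (h : f x = g x) :
    HasSlope (fun y => max (f y) (g y)) x d (max m n) := by
  filter_upwards [hf, hg, self_mem_nhdsWithin] with s h1 h2 (h3 : 0 < s)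
  rw [h1, h2, h, max_self, max_add_add_left, max_mul_of_nonneg _ _ h3.le]

end HasSlope

namespace IsLocAffine

variable {f g : G.Point → ℝ}

theorem const (c : ℝ) : IsLocAffine (fun _ : G.Point => c) :=
  fun _ _ _ => ⟨0, by simpa using HasSlope.const c⟩

theorem add (hf : IsLocAffine f) (hg : IsLocAffine g) : IsLocAffine (fun y => f y + g y) := by
  intro x d hd
  obtain ⟨m, hm⟩ := hf x d hd
  obtain ⟨n, hn⟩ := hg x d hd
  exact ⟨m + n, by simpa using hm.add hn⟩

theorem neg (hf : IsLocAffine f) : IsLocAffine (fun y => -f y) := by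
  intro x d hd
  obtain ⟨m, hm⟩ := hf x d hd
  exact ⟨-m, by simpa using hm.neg⟩

theorem max (hf : IsLocAffine f) (hg : IsLocAffine g) :
    IsLocAffine (fun y => max (f y) (g y)) := by
  intro x d hd
  obtain ⟨m, hm⟩ := hf x d hd
  obtain ⟨n, hn⟩ := hg x d hd
  rcases lt_trichotomy (f x) (g x) with h | h | h
  · exact ⟨n, hm.max_of_lt hn h⟩
  · exact ⟨Max.max m n, by simpa using hm.max_of_eq hn h⟩
  · refine ⟨m, ?_⟩
    simp_rw [max_comm (f _)]
    exact hn.max_of_lt hm h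

theorem continuous (hf : IsLocAffine f) : Continuous f :=
  continuous_of_tendsto_ray fun x d hd => (hf x d hd).choose_spec.tendsto

end IsLocAffine

theorem IsRational.isLocAffine {f : G.Point → ℝ} (hf : G.IsRational f) : IsLocAffine f := by
  rintro x ⟨e, b⟩ hd
  obtain ⟨S, hS⟩ := hf.piecewise_affine e
  set t := G.start x (e, b) with ht
  obtain ⟨δ, hδ, h⟩ := eventually_nhdsGT_zero_iff.1 hd.eventually_mem_Ioo
  have hx : G.edge e t = x := by
    have := hd.ray_zero
    rwa [ray, mul_zero, add_zero] at this
  -- The value `s = 0` may be an end of the edge; it is reached as a limit of interior parameters.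
  have hcl : ∀ s, 0 ≤ s → s < δ → t + dirSign b * s ∈ Icc 0 (G.len e) := by
    intro s h0 h1
    rcases h0.eq_or_lt with rfl | h0
    · have hc : ContinuousWithinAt (fun s => t + dirSign b * s) (Ioo 0 δ) 0 :=
        (Continuous.continuousWithinAt (by fun_prop))
      refine isClosed_Icc.closure_subset (hc.mem_closure ?_ fun s hs =>
        Ioo_subset_Icc_self (h s hs.1 hs.2))
      rw [closure_Ioo hδ.ne]
      exact left_mem_Icc.2 hδ.le
    · exact Ioo_subset_Icc_self (h s h0 h1)
  have hSfin : ∀ᶠ s in 𝓝[>] (0 : ℝ), ∀ c ∈ S, t + dirSign b * s ≠ c := by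
    rw [Finset.eventually_all]
    intro c _
    by_cases hc : t = c
    · filter_upwards [self_mem_nhdsWithin] with s (hs : 0 < s) h1
      unfold dirSign at h1
      split_ifs at h1 <;> linarith
    · have : Tendsto (fun s : ℝ => t + dirSign b * s) (𝓝 0) (𝓝 (t + dirSign b * 0)) :=
        Continuous.tendsto (by fun_prop) 0
      rw [mul_zero, add_zero] at this
      exact nhdsWithin_le_nhds (this.eventually_ne hc)
  obtain ⟨η, hη, h'⟩ := eventually_nhdsGT_zero_iff.1 hSfin
  obtain ⟨r, hr0, hrδ, hrη⟩ : ∃ r, 0 < r ∧ r < δ ∧ r < η :=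
    ⟨min δ η / 2, by positivity, by linarith [min_le_left δ η, lt_min hδ hη],
      by linarith [min_le_right δ η, lt_min hδ hη]⟩
  cases b with
  | true =>
    simp only [dirSign, if_true, one_mul] at hcl h'
    obtain ⟨m, hm⟩ := hS t (t + r) (by simpa using (hcl 0 le_rfl hδ).1) (by linarith)
      (hcl r hr0.le hrδ).2 fun s hs hs' => h' (s - t) (by linarith [hs'.1])
        (by linarith [hs'.2]) s hs (by ring)
    refine ⟨m, eventually_nhdsGT_zero_iff.2 ⟨r, hr0, fun s h0 h1 => ?_⟩⟩
    have := hm (t + s) ⟨by linarith, by linarith⟩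
    simp only [ray, dirSign, if_true, one_mul, ← ht]
    rw [this, hx]; ring
  | false =>
    simp only [dirSign, Bool.false_eq_true, if_false, neg_one_mul, ← sub_eq_add_neg] at hcl h'
    obtain ⟨m, hm⟩ := hS (t - r) t (hcl r hr0.le hrδ).1 (by linarith)
      (by simpa using (hcl 0 le_rfl hδ).2) fun s hs hs' => h' (t - s) (by linarith [hs'.2])
        (by linarith [hs'.1]) s hs (by ring)
    refine ⟨-m, eventually_nhdsGT_zero_iff.2 ⟨r, hr0, fun s h0 h1 => ?_⟩⟩
    have h1 := hm (t - s) ⟨by linarith, by linarith⟩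
    have h2 := hm t ⟨by linarith, by linarith⟩
    simp only [ray, dirSign, Bool.false_eq_true, if_false, neg_one_mul, ← sub_eq_add_neg, ← ht]
    rw [h1, ← hx, h2]; push_cast; ring

/-- Compactness of the edge, in the form of real induction: the set `P` of those `l` for which `[0,
l]` has finitely many breakpoints is closed by affineness to the left of a point, and extends to the
right by affineness there, at the cost of one new breakpoint. -/
theorem IsLocAffine.exists_breakpoints {f : G.Point → ℝ} (hf : IsLocAffine f) (e : E) :
    ∃ S : Finset ℝ, ∀ a b : ℝ, 0 ≤ a → a ≤ b → b ≤ G.len e → (∀ s ∈ S, s ∉ Ioo a b) →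
      ∃ m : ℤ, ∀ t ∈ Icc a b, f (G.edge e t) = f (G.edge e a) + m * (t - a) := by
  let P : Set ℝ := {l | ∃ S : Finset ℝ, ∀ a b : ℝ, 0 ≤ a → a ≤ b → b ≤ l → (∀ s ∈ S, s ∉ Ioo a b) →
      ∃ m : ℤ, ∀ t ∈ Icc a b, f (G.edge e t) = f (G.edge e a) + m * (t - a)}
  have hmono : ∀ l l', l ≤ l' → l' ∈ P → l ∈ P := fun l l' h ⟨S, hS⟩ =>
    ⟨S, fun a b h0 h1 h2 => hS a b h0 h1 (h2.trans h)⟩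
  have hext : ∀ l l' : ℝ, l ≤ l' → l ∈ P →
      (∃ (c : ℝ) (m : ℤ), ∀ t ∈ Icc l l', f (G.edge e t) = c + m * t) → l' ∈ P := by
    rintro l l' hl ⟨S, hS⟩ ⟨c, m, hm⟩
    refine ⟨insert l S, fun a b h0 h1 h2 h3 => ?_⟩
    rcases le_or_gt b l with hb | hb
    · exact hS a b h0 h1 hb fun s hs => h3 s (Finset.mem_insert_of_mem hs)
    · have ha : l ≤ a := by
        by_contra! h
        exact h3 l (Finset.mem_insert_self _ _) ⟨h, hb⟩
      refine ⟨m, fun t ht => ?_⟩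
      rw [hm t ⟨ha.trans ht.1, ht.2.trans h2⟩, hm a ⟨ha, h1.trans h2⟩]; ring
  have hl := G.len_pos e
  have key : Icc 0 (G.len e) ⊆ P := by
    have : IsClosed (P ∩ Icc 0 (G.len e)) := by
      refine isClosed_of_closure_subset fun l hl => ?_
      have hlI : l ∈ Icc 0 (G.len e) := isClosed_Icc.closure_subset_iff.2 inter_subset_right hl
      refine ⟨?_, hlI⟩
      rcases hlI.1.eq_or_lt with rfl | h0
      · refine ⟨∅, fun a b h0 h1 h2 _ => ⟨0, fun t ht => ?_⟩⟩
        rw [show t = a by linarith [ht.1, ht.2]]; simp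
      obtain ⟨hd, hr⟩ := isDir_false h0 hlI.2
      obtain ⟨m, hm⟩ := hf _ _ hd
      simp only [HasSlope, hr] at hm
      obtain ⟨δ, hδ, h⟩ := eventually_nhdsGT_zero_iff.1 hm
      obtain ⟨u, hu, hu'⟩ := mem_closure_iff_nhds.1 hl (Ioi (l - δ)) (Ioi_mem_nhds (by linarith))
      rcases le_or_gt l u with h1 | h1
      · exact hmono _ _ h1 hu'.1
      · refine hext u l h1.le hu'.1 ⟨f (G.edge e l) + m * l, -m, fun t ht => ?_⟩
        rcases ht.2.eq_or_lt with rfl | h2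
        · push_cast; ring
        · have := h (l - t) (by linarith) (by have : l - δ < u := hu; linarith [ht.1])
          rw [sub_sub_cancel] at this
          rw [this]; push_cast; ring
    refine this.Icc_subset_of_forall_exists_gt ?_ ?_
    · refine ⟨∅, fun a b h0 h1 h2 _ => ⟨0, fun t ht => ?_⟩⟩
      rw [show t = a by linarith [ht.1, ht.2]]; simp
    · intro l hl y hy
      obtain ⟨hd, hr⟩ := isDir_true hl.2.1 hl.2.2
      obtain ⟨m, hm⟩ := hf _ _ hd
      simp only [HasSlope, hr] at hm
      obtain ⟨δ, hδ, h⟩ := eventually_nhdsGT_zero_iff.1 hm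
      have hy : l < y := hy
      obtain ⟨r, hr0, hr1, hr2⟩ : ∃ r, 0 < r ∧ r < δ ∧ r ≤ y - l :=
        ⟨min δ (y - l) / 2, by have := lt_min hδ (sub_pos.2 hy); positivity,
          by linarith [min_le_left δ (y - l), lt_min hδ (sub_pos.2 hy)],
          by linarith [min_le_right δ (y - l), lt_min hδ (sub_pos.2 hy)]⟩
      refine ⟨l + r, ?_, by linarith, by linarith⟩
      refine hext l _ (by linarith) hl.1 ⟨f (G.edge e l) - m * l, m, fun t ht => ?_⟩
      rcases ht.1.eq_or_lt with rfl | h2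
      · ring
      · have := h (t - l) (by linarith) (by linarith [ht.2])
        rw [add_sub_cancel] at this
        rw [this]; ring
  exact key (right_mem_Icc.2 hl.le)

theorem isRational_iff {f : G.Point → ℝ} : G.IsRational f ↔ IsLocAffine f :=
  ⟨IsRational.isLocAffine, fun h => ⟨h.continuous, h.exists_breakpoints⟩⟩

variable [Fintype E]

/-- The order at a point is the sum of the slopes in the tangent directions. -/
theorem ord_eq_sum {f : G.Point → ℝ} {x : G.Point} {m : E × Bool → ℝ}
    (h : ∀ d, G.IsDir x d → HasSlope f x d (m d)) : G.ord f x = ∑ d ∈ G.dirs x, m d := by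
  cases x with
  | vertex v =>
    have h1 : ∀ e, G.src e = v → G.slopeForward f e 0 = m (e, true) := by
      intro e he
      refine derivWithin_Ici_of_eventually ?_
      have := h (e, true) he
      simpa [HasSlope, ray, start, dirSign, edge_of_nonpos, he] using this
    have h2 : ∀ e, G.tgt e = v → G.slopeBackward f e (G.len e) = m (e, false) := by
      intro e he
      rw [slopeBackward, neg_eq_iff_eq_neg]
      refine derivWithin_Iic_of_eventually ?_
      have := h (e, false) he
      simpa [HasSlope, ray, start, dirSign, edge_of_len_le, he, sub_eq_add_neg] using this
    rw [ord, dirs, Finset.sum_filter, Fintype.sum_prod_type, ← Finset.sum_add_distrib]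
    refine Finset.sum_congr rfl fun e _ => ?_
    rw [Fintype.sum_bool]
    congr 1
    · by_cases he : G.src e = v <;> simp [IsDir, dirVertex, he, h1]
    · by_cases he : G.tgt e = v <;> simp [IsDir, dirVertex, he, h2]
  | inner e t =>
    have h1 : G.slopeForward f e t = m (e, true) := by
      refine derivWithin_Ici_of_eventually ?_
      have := h (e, true) rfl
      simpa [HasSlope, ray, start, dirSign, edge_of_mem G t.2] using this
    have h2 : G.slopeBackward f e t = m (e, false) := by
      rw [slopeBackward, neg_eq_iff_eq_neg]
      refine derivWithin_Iic_of_eventually ?_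
      have := h (e, false) rfl
      simpa [HasSlope, ray, start, dirSign, edge_of_mem G t.2, sub_eq_add_neg] using this
    rw [ord, h1, h2, dirs, Finset.sum_filter, Fintype.sum_prod_type,
      Finset.sum_eq_single e (fun b _ hb => by simp [IsDir, hb]) (by simp), Fintype.sum_bool]
    simp [IsDir]

end WeightedGraph

/-! ### Principal divisors have degree zero. -/

/-- Think of `r` and `l` as the outgoing slopes to the right and to the left. Between consecutive
breakpoints the slopes at the two ends cancel, and the total telescopes; the induction splits off
the last breakpoint. -/
theorem sum_slopes_eq_zero {r l : ℝ → ℤ} (T : Finset ℝ) : ∀ L : ℝ, 0 < L →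
    (∀ t ∈ T, t ∈ Ioo 0 L) →
    (∀ a b, 0 ≤ a → a < b → b ≤ L → (∀ t ∈ T, t ∉ Ioo a b) → r a + l b = 0) →
    r 0 + l L + ∑ t ∈ T, (r t + l t) = 0 := by
  classical
  induction T using Finset.induction_on_max with
  | empty => intro L hL _ h; simpa using h 0 L le_rfl hL le_rfl (by simp)
  | insert s T hs ih =>
    intro L hL hT h
    have hsL := hT s (Finset.mem_insert_self _ _)
    have h1 := ih s hsL.1 (fun t ht => ⟨(hT t (Finset.mem_insert_of_mem ht)).1, hs t ht⟩)
      fun a b h0 h1 h2 h3 => h a b h0 h1 (h2.trans hsL.2.le) fun t ht => by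
        rcases Finset.mem_insert.1 ht with rfl | ht
        · exact fun h => absurd h.2 (not_lt.2 h2)
        · exact h3 t ht
    have h2 := h s L hsL.1.le hsL.2 le_rfl fun t ht => by
      rcases Finset.mem_insert.1 ht with rfl | ht
      · exact fun h => lt_irrefl _ h.1
      · exact fun h => lt_asymm h.1 (hs t ht)
    rw [Finset.sum_insert fun h => lt_irrefl _ (hs s h)]
    linarith

namespace WeightedGraph

variable {V E : Type u} {G : WeightedGraph V E}

theorem Divisor.degree_nonneg {D : G.Divisor} (h : 0 ≤ D) : 0 ≤ Finsupp.degree D :=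
  Finset.sum_nonneg fun x _ => h x

theorem Divisor.eq_zero_of_degree {D : G.Divisor} (h : 0 ≤ D) (h0 : Finsupp.degree D = 0) :
    D = 0 := by
  ext x
  by_contra hx
  rw [Finsupp.degree_apply, Finset.sum_eq_zero_iff_of_nonneg fun x _ => h x] at h0
  exact hx (h0 x (Finsupp.mem_support_iff.2 hx))

variable [Fintype V] [Fintype E]

open Classical in
/-- The divisor of a rational function has finite support and degree zero. -/
theorem IsLocAffine.exists_div {f : G.Point → ℝ} (hf : IsLocAffine f) :
    ∃ P : G.Divisor, (∀ x, (P x : ℝ) = G.ord f x) ∧ Finsupp.degree P = 0 := by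
  choose S hS using hf.exists_breakpoints
  choose! m hm using hf
  have hord : ∀ x, G.ord f x = ((∑ d ∈ G.dirs x, m x d : ℤ) : ℝ) := fun x => by
    rw [ord_eq_sum (hm x)]; push_cast; rfl
  set o : G.Point → ℤ := fun x => ∑ d ∈ G.dirs x, m x d
  let r : E → ℝ → ℤ := fun e t => m (G.edge e t) (e, true)
  let l : E → ℝ → ℤ := fun e t => m (G.edge e t) (e, false)
  let T : E → Finset ℝ := fun e => (S e).filter (· ∈ Ioo 0 (G.len e))
  have hT : ∀ e, ∀ t ∈ T e, t ∈ Ioo 0 (G.len e) := fun e t ht => (Finset.mem_filter.1 ht).2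
  have hrl : ∀ e a b, 0 ≤ a → a < b → b ≤ G.len e → (∀ t ∈ T e, t ∉ Ioo a b) →
      r e a + l e b = 0 := by
    intro e a b h0 h1 h2 h3
    obtain ⟨k, hk⟩ := hS e a b h0 h1.le h2 fun s hs hs' => h3 s (Finset.mem_filter.2
      ⟨hs, h0.trans_lt hs'.1, hs'.2.trans_le h2⟩) hs'
    obtain ⟨hd, hr⟩ := isDir_true h0 (h1.trans_le h2)
    obtain ⟨hd', hr'⟩ := isDir_false (h0.trans_lt h1) h2
    have e1 : HasSlope f (G.edge e a) (e, true) k :=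
      eventually_nhdsGT_zero_iff.2 ⟨b - a, by linarith, fun s hs hs' => by
        rw [hr, hk _ ⟨by linarith, by linarith⟩]; ring⟩
    have e2 : HasSlope f (G.edge e b) (e, false) (-k : ℝ) :=
      eventually_nhdsGT_zero_iff.2 ⟨b - a, by linarith, fun s hs hs' => by
        rw [hr', hk _ ⟨by linarith, by linarith⟩, hk b ⟨h1.le, le_rfl⟩]; ring⟩
    have u1 := (hm _ _ hd).unique e1
    have u2 := (hm _ _ hd').unique e2
    have : ((r e a + l e b : ℤ) : ℝ) = 0 := by
      push_cast
      change (m (G.edge e a) (e, true) : ℝ) + m (G.edge e b) (e, false) = 0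
      rw [u1, u2]; ring
    exact_mod_cast this
  have hoin : ∀ e t, t ∈ Ioo 0 (G.len e) → o (G.edge e t) = r e t + l e t := by
    intro e t ht
    simp only [o, r, l]
    rw [edge_of_mem G ht, dirs, Finset.sum_filter, Fintype.sum_prod_type,
      Finset.sum_eq_single e (fun b _ hb => by simp [IsDir, hb]) (by simp), Fintype.sum_bool]
    simp [IsDir]
  -- The order can only be nonzero at vertices and at breakpoints interior to an edge.
  refine ⟨∑ v, Finsupp.single (Point.vertex v) (o (Point.vertex v)) +
    ∑ e, ∑ t ∈ T e, Finsupp.single (G.edge e t) (o (G.edge e t)), fun x => ?_, ?_⟩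
  · rw [hord]
    norm_cast
    rw [Finsupp.add_apply, Finsupp.finsetSum_apply, Finsupp.finsetSum_apply]
    simp only [Finsupp.finsetSum_apply]
    cases x with
    | vertex v =>
      rw [Finset.sum_eq_single v (fun w _ hw => by simp [hw]) (by simp)]
      rw [Finset.sum_eq_zero fun e _ => Finset.sum_eq_zero fun t ht => by
        rw [edge_of_mem G (hT e t ht)]; simp]
      simp [o]
    | inner e t =>
      rw [Finset.sum_eq_zero fun v _ => by simp]
      rw [Finset.sum_eq_single e (fun e' _ he => Finset.sum_eq_zero fun s hs => by
        rw [edge_of_mem G (hT e' s hs)]; simp [he]) (by simp)]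
      have hx : G.edge e t = Point.inner e t := edge_of_mem G t.2
      by_cases ht : (t : ℝ) ∈ T e
      · rw [Finset.sum_eq_single (t : ℝ) (fun s hs hst => ?_) (fun h => absurd ht h), hx]
        · simp [o]
        · rw [edge_of_mem G (hT e s hs), Finsupp.single_apply, if_neg]
          rintro h
          injection h with _ h
          exact hst (congrArg Subtype.val h)
      · rw [Finset.sum_eq_zero fun s hs => ?_]
        · change _ = o (Point.inner e t)
          rw [← hx, hoin e t t.2]
          have t0 := t.2.1
          have t1 := t.2.2
          obtain ⟨δ, hδ, hδ'⟩ : ∃ δ > 0, ∀ s ∈ T e, s ∉ Ioo ((t : ℝ) - δ) (t + δ) := by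
            have : (↑(T e) : Set ℝ)ᶜ ∈ 𝓝 (t : ℝ) :=
              (T e).finite_toSet.isClosed.isOpen_compl.mem_nhds ht
            obtain ⟨δ, hδ, h⟩ := Metric.mem_nhds_iff.1 this
            refine ⟨δ, hδ, fun s hs hs' => h ?_ hs⟩
            rw [Real.ball_eq_Ioo]; exact hs'
          obtain ⟨η, h0, h1, h2, h3⟩ : ∃ η, 0 < η ∧ η ≤ δ ∧ η ≤ t ∧ η ≤ G.len e - t :=
            ⟨min δ (min t (G.len e - t)), lt_min hδ (lt_min t0 (by linarith)), min_le_left _ _,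
              (min_le_right _ _).trans (min_le_left _ _),
              (min_le_right _ _).trans (min_le_right _ _)⟩
          -- Away from breakpoints, cancellation on the two halves minus cancellation on the whole
          -- interval leaves `r e t + l e t = 0`.
          have hA := hrl e (t - η) (t + η) (by linarith) (by linarith) (by linarith)
            fun s hs hs' => hδ' s hs ⟨by linarith [hs'.1], by linarith [hs'.2]⟩
          have hB := hrl e (t - η) t (by linarith) (by linarith) (by linarith)
            fun s hs hs' => hδ' s hs ⟨by linarith [hs'.1], by linarith [hs'.2]⟩
          have hC := hrl e t (t + η) (by linarith) (by linarith) (by linarith)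
            fun s hs hs' => hδ' s hs ⟨by linarith [hs'.1], by linarith [hs'.2]⟩
          linarith
        · rw [edge_of_mem G (hT e s hs), Finsupp.single_apply, if_neg]
          rintro h
          injection h with _ h
          exact ht (by rw [← h]; exact hs)
  · rw [map_add, map_sum, map_sum]
    simp only [map_sum, Finsupp.degree_single]
    -- Each edge end is a direction at exactly one vertex, so the vertex contributions can be
    -- regrouped by edges.
    have hv : ∑ v, o (Point.vertex v) = ∑ e, (r e 0 + l e (G.len e)) := by
      have : ∀ v, o (Point.vertex v) =
          ∑ d with G.dirVertex d = v, m (Point.vertex (G.dirVertex d)) d := by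
        intro v
        refine Finset.sum_congr ?_ fun d hd => ?_
        · ext d; simp [IsDir]
        · rw [(Finset.mem_filter.1 hd).2]
      simp only [this]
      refine (Finset.sum_fiberwise Finset.univ G.dirVertex
        fun d => m (Point.vertex (G.dirVertex d)) d).trans ?_
      rw [Fintype.sum_prod_type]
      refine Finset.sum_congr rfl fun e _ => ?_
      rw [Fintype.sum_bool]
      simp [r, l, edge_of_nonpos, edge_of_len_le, dirVertex]
    rw [hv, ← Finset.sum_add_distrib]
    refine Finset.sum_eq_zero fun e _ => ?_
    rw [Finset.sum_congr rfl fun t ht => hoin e t (hT e t ht)]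
    exact sum_slopes_eq_zero (T e) _ (G.len_pos e) (hT e) (hrl e)

/-! ### Linear systems, rank, and the reduction to removing one point. -/

theorem linearSystem_nonempty_iff {D : G.Divisor} : (G.linearSystem D).Nonempty ↔
    ∃ f : G.Point → ℝ, IsLocAffine f ∧ ∀ x, 0 ≤ (D x : ℝ) + G.ord f x := by
  constructor
  · rintro ⟨F, hF, f, hf, h⟩
    refine ⟨f, hf.isLocAffine, fun x => ?_⟩
    rw [← h x]
    exact_mod_cast hF x
  · rintro ⟨f, hf, h⟩
    obtain ⟨P, hP, -⟩ := hf.exists_div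
    refine ⟨D + P, fun x => ?_, f, isRational_iff.2 hf, fun x => ?_⟩
    · have := h x
      rw [← hP x] at this
      exact_mod_cast this
    · rw [Finsupp.add_apply, ← hP x]; push_cast; rfl

theorem degree_nonneg_of_linearSystem_nonempty {D : G.Divisor}
    (h : (G.linearSystem D).Nonempty) : 0 ≤ Finsupp.degree D := by
  obtain ⟨f, hf, h⟩ := linearSystem_nonempty_iff.1 h
  obtain ⟨P, hP, h0⟩ := hf.exists_div
  have : 0 ≤ D + P := fun x => by
    have := h x
    rw [← hP x] at this
    exact_mod_cast this
  have := Divisor.degree_nonneg this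
  rwa [map_add, h0, add_zero] at this

theorem linearSystem_nonempty_of_le {D D' : G.Divisor} (hD : D ≤ D')
    (h : (G.linearSystem D).Nonempty) : (G.linearSystem D').Nonempty := by
  rw [linearSystem_nonempty_iff] at h ⊢
  obtain ⟨f, hf, h⟩ := h
  refine ⟨f, hf, fun x => (h x).trans ?_⟩
  gcongr
  exact_mod_cast hD x

/-- The infimum is over a nonempty set, since `D - F` has negative degree once `F` has degree above
that of `D`; thus the default value of `sInf` does not intervene. An obstruction of degree below `k`
is padded with copies of one point to an obstruction of degree `k`. -/
theorem natCast_le_rank_iff [Nonempty G.Point] {D : G.Divisor} {k : ℕ} : (k : ℤ) ≤ G.rank D ↔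
    ∀ F : G.Divisor, 0 ≤ F → Finsupp.degree F = k → (G.linearSystem (D - F)).Nonempty := by
  classical
  let p : G.Point := Classical.arbitrary _
  set N := {n : ℕ | ∃ F : G.Divisor,
    0 ≤ F ∧ Finsupp.degree F = (n : ℤ) ∧ G.linearSystem (D - F) = ∅}
  have hr : G.rank D = (sInf N : ℕ) - 1 := rfl
  have hne : N.Nonempty := by
    refine ⟨(Finsupp.degree D).toNat + 1, Finsupp.single p ((Finsupp.degree D).toNat + 1),
      ?_, ?_, ?_⟩
    · exact Finsupp.single_nonneg.2 (by positivity)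
    · simp
    · rw [← Set.not_nonempty_iff_eq_empty]
      intro h
      have := degree_nonneg_of_linearSystem_nonempty h
      rw [map_sub, Finsupp.degree_single] at this
      have := Int.self_le_toNat (Finsupp.degree D)
      linarith
  have hk : (k : ℤ) ≤ G.rank D ↔ k < sInf N := by rw [hr]; omega
  rw [hk]
  constructor
  · intro h F hF hd
    rw [Set.nonempty_iff_ne_empty]
    intro he
    exact Nat.notMem_of_lt_sInf h ⟨F, hF, hd, he⟩
  · intro h
    by_contra! hlt
    obtain ⟨F, hF, hd, he⟩ := Nat.sInf_mem hne
    have h1 := h (F + Finsupp.single p ((k : ℤ) - sInf N))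
      (add_nonneg hF (Finsupp.single_nonneg.2 (by omega))) (by simp [hd])
    have h2 : (G.linearSystem (D - F)).Nonempty := by
      refine linearSystem_nonempty_of_le ?_ h1
      rw [← sub_sub]
      exact sub_le_self _ (Finsupp.single_nonneg.2 (by omega))
    rw [he] at h2
    exact Set.not_nonempty_empty h2

theorem rank_nonneg_iff [Nonempty G.Point] {D : G.Divisor} :
    0 ≤ G.rank D ↔ (G.linearSystem D).Nonempty := by
  have := natCast_le_rank_iff (D := D) (k := 0)
  rw [Nat.cast_zero] at this
  rw [this]
  constructor
  · intro h; simpa using h 0 le_rfl (map_zero _)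
  · intro h F hF hd
    rw [Divisor.eq_zero_of_degree hF hd, sub_zero]
    exact h

/-- A set is rank-determining as soon as it detects that the complete linear systems
`|D - x|` are all nonempty. -/
theorem isRankDetermining_of_forall [Nonempty G.Point] {A : Set G.Point}
    (H : ∀ D : G.Divisor, (∀ a ∈ A, (G.linearSystem (D - Finsupp.single a 1)).Nonempty) →
      ∀ p, (G.linearSystem (D - Finsupp.single p 1)).Nonempty) : G.IsRankDetermining A := by
  classical
  have key : ∀ (k : ℕ) (D : G.Divisor), (∀ F : G.Divisor, 0 ≤ F → Finsupp.degree F = k →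
      (F.support : Set G.Point) ⊆ A → (G.linearSystem (D - F)).Nonempty) →
      ∀ F : G.Divisor, 0 ≤ F → Finsupp.degree F = k → (G.linearSystem (D - F)).Nonempty := by
    intro k
    induction k with
    | zero =>
      intro D h F hF hd
      rw [Divisor.eq_zero_of_degree hF hd]
      exact h 0 le_rfl (map_zero _) (by simp)
    | succ k ih =>
      intro D h F hF hd
      obtain ⟨p, hp⟩ : ∃ p, F p ≠ 0 := by
        by_contra! h0
        have : F = 0 := Finsupp.ext h0
        rw [this, map_zero] at hd
        push_cast at hd; omega
      have hF' : 0 ≤ F - Finsupp.single p 1 := by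
        intro x
        have := hF x
        rw [Finsupp.coe_zero, Pi.zero_apply] at this
        rw [Finsupp.sub_apply, Finsupp.single_apply]
        split_ifs with hx
        · subst hx; change 0 ≤ _; omega
        · change 0 ≤ _; omega
      have hd' : Finsupp.degree (F - Finsupp.single p 1) = (k : ℤ) := by
        rw [map_sub, hd, Finsupp.degree_single]; push_cast; ring
      -- The point `p` of `F` is traded for points `a` of `A`; for each of these the remaining `F -
      -- p` is handled by induction, applied to `D - a`.
      have := H (D - (F - Finsupp.single p 1)) (fun a ha => ?_) p
      · rwa [sub_sub, sub_add_cancel] at this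
      rw [sub_right_comm]
      refine ih (D - Finsupp.single a 1) (fun F' hF'' hd'' hs => ?_) _ hF' hd'
      rw [sub_sub]
      refine h _ (add_nonneg (Finsupp.single_nonneg.2 zero_le_one) hF'') ?_ ?_
      · rw [map_add, hd'', Finsupp.degree_single]; push_cast; ring
      · intro x hx
        by_cases hxa : x = a
        · exact hxa ▸ ha
        · refine hs ?_
          simpa [Finsupp.single_apply, Ne.symm hxa] using hx
  intro D
  constructor
  · intro F hF hd _
    have h0 := Divisor.degree_nonneg hF
    rw [hd] at h0
    obtain ⟨k, hk⟩ := Int.eq_ofNat_of_zero_le h0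
    exact rank_nonneg_iff.2 (natCast_le_rank_iff.1 hk.ge F hF (hd.trans hk))
  · intro r hr
    rcases lt_or_ge r 0 with h | h
    -- Negative `r` belong to the set trivially, so the bound has to come from the rank being at
    -- least `-1`.
    · have : (-1 : ℤ) ≤ G.rank D := by unfold rank; omega
      omega
    · obtain ⟨k, rfl⟩ := Int.eq_ofNat_of_zero_le h
      exact natCast_le_rank_iff.2 (key k D fun F hF hd hs => rank_nonneg_iff.1 (hr F hF hd hs))

end WeightedGraph

/-! ### Convexity and integral subgradients in one variable. -/

/-- At the last point where a positive maximum is attained, the slope to the left is at most zero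
and the slope to the right is negative, so their sum cannot be nonnegative. -/
theorem nonpos_of_slopes_nonneg {ψ : ℝ → ℝ} {a b : ℝ} (hab : a ≤ b)
    (hc : ContinuousOn ψ (Icc a b))
    (hψ : ∀ s ∈ Ioo a b, ∃ r l : ℝ, 0 ≤ r + l ∧ (∀ᶠ u in 𝓝[>] (0 : ℝ), ψ (s + u) = ψ s + r * u) ∧
      ∀ᶠ u in 𝓝[>] (0 : ℝ), ψ (s - u) = ψ s + l * u)
    (ha : ψ a ≤ 0) (hb : ψ b ≤ 0) : ∀ s ∈ Icc a b, ψ s ≤ 0 := by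
  obtain ⟨t₀, ht₀, hmax⟩ := isCompact_Icc.exists_isMaxOn (nonempty_Icc.2 hab) hc
  by_contra! hpos
  obtain ⟨s, hs, hs0⟩ := hpos
  have hM : 0 < ψ t₀ := hs0.trans_le (hmax hs)
  have hcl : IsCompact (Icc a b ∩ ψ ⁻¹' {ψ t₀}) :=
    isCompact_Icc.of_isClosed_subset (hc.preimage_isClosed_of_isClosed isClosed_Icc
      isClosed_singleton) inter_subset_left
  obtain ⟨t, ⟨htI, htM⟩, hlast⟩ := hcl.exists_isGreatest ⟨t₀, ht₀, rfl⟩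
  have htM : ψ t = ψ t₀ := htM
  have hta : a < t := htI.1.lt_of_ne (by rintro rfl; linarith)
  have htb : t < b := htI.2.lt_of_ne (by rintro rfl; linarith)
  obtain ⟨r, l, hrl, hr, hl⟩ := hψ t ⟨hta, htb⟩
  obtain ⟨δ₁, hδ₁, hr⟩ := eventually_nhdsGT_zero_iff.1 hr
  obtain ⟨δ₂, hδ₂, hl⟩ := eventually_nhdsGT_zero_iff.1 hl
  obtain ⟨u, hu0, h1, h2, h3, h4⟩ : ∃ u, 0 < u ∧ u < δ₁ ∧ u < δ₂ ∧ u < t - a ∧ u < b - t := by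
    have hev : ∀ c : ℝ, 0 < c → ∀ᶠ u in 𝓝[>] (0 : ℝ), u < c := fun c hc =>
      nhdsWithin_le_nhds (eventually_lt_nhds hc)
    obtain ⟨u, h, h'⟩ := ((hev δ₁ hδ₁).and ((hev δ₂ hδ₂).and ((hev (t - a) (by linarith)).and
      ((hev (b - t) (by linarith)).and self_mem_nhdsWithin)))).exists
    exact ⟨u, h'.2.2.2, h, h'.1, h'.2.1, h'.2.2.1⟩
  have hL : ψ (t - u) ≤ ψ t₀ := hmax ⟨by linarith, by linarith⟩
  have hR : ψ (t + u) < ψ t₀ := by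
    refine lt_of_le_of_ne (hmax ⟨by linarith, by linarith⟩) fun h => ?_
    have := hlast ⟨⟨by linarith, by linarith⟩, h⟩
    linarith
  rw [hl u hu0 h2, htM] at hL
  rw [hr u hu0 h1, htM] at hR
  nlinarith

/-- Subtracting a chord does not change the sum of the two slopes at a point, so the maximum
principle just proved puts the function below each chord. -/
theorem convexOn_of_slopes_nonneg {φ : ℝ → ℝ} {δ : ℝ} (hc : ContinuousOn φ (Icc 0 δ))
    (hφ : ∀ s ∈ Ioo 0 δ, ∃ r l : ℝ, 0 ≤ r + l ∧
      (∀ᶠ u in 𝓝[>] (0 : ℝ), φ (s + u) = φ s + r * u) ∧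
      ∀ᶠ u in 𝓝[>] (0 : ℝ), φ (s - u) = φ s + l * u) : ConvexOn ℝ (Icc 0 δ) φ := by
  refine LinearOrder.convexOn_of_lt (convex_Icc _ _) fun x hx y hy hxy a b ha hb hab => ?_
  set k := (φ y - φ x) / (y - x) with hk
  have hk' : k * (y - x) = φ y - φ x := div_mul_cancel₀ _ (by linarith)
  have := nonpos_of_slopes_nonneg (ψ := fun s => φ s - (φ x + k * (s - x))) hxy.le
    ((hc.mono (Icc_subset_Icc hx.1 hy.2)).sub (by fun_prop)) (fun s hs => ?_) (by simp)
    (show φ y - (φ x + k * (y - x)) ≤ 0 by linarith) (a * x + b * y)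
    ⟨by rw [← sub_eq_iff_eq_add.2 hab.symm]; nlinarith,
      by rw [← sub_eq_iff_eq_add.2 hab.symm]; nlinarith⟩
  · simp only [smul_eq_mul]
    have e : a * x + b * y - x = b * (y - x) := by
      rw [show a = 1 - b by linarith]; ring
    rw [e] at this
    rw [show a = 1 - b by linarith] at this ⊢
    nlinarith
  · obtain ⟨r, l, hrl, hr, hl⟩ := hφ s ⟨hx.1.trans_lt hs.1, hs.2.trans_le hy.2⟩
    refine ⟨r - k, l + k, by linarith, ?_, ?_⟩
    · filter_upwards [hr] with u hu
      rw [hu]; ring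
    · filter_upwards [hl] with u hu
      rw [hu]; ring

theorem ConvexOn.add_mul_sub_le {φ : ℝ → ℝ} {δ s₀ m : ℝ} (hφ : ConvexOn ℝ (Icc 0 δ) φ)
    (h0 : 0 ≤ s₀) (h1 : s₀ < δ) (hm : ∀ᶠ u in 𝓝[>] (0 : ℝ), φ (s₀ + u) = φ s₀ + m * u) :
    ∀ s ∈ Icc 0 δ, φ s₀ + m * (s - s₀) ≤ φ s := by
  intro s hs
  have hev : ∀ c : ℝ, 0 < c → ∀ᶠ u in 𝓝[>] (0 : ℝ), u < c := fun c hc =>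
    nhdsWithin_le_nhds (eventually_lt_nhds hc)
  rcases lt_trichotomy s s₀ with h | rfl | h
  · obtain ⟨u, hu, hu1, (hu0 : 0 < u)⟩ :=
      (hm.and ((hev (δ - s₀) (by linarith)).and self_mem_nhdsWithin)).exists
    have := hφ.slope_mono_adjacent hs ⟨by linarith, by linarith⟩ h
      (show s₀ < s₀ + u by linarith)
    rw [hu, add_sub_cancel_left, add_sub_cancel_left, mul_div_cancel_right₀ _ hu0.ne',
      div_le_iff₀ (by linarith)] at this
    linarith
  · simp
  · obtain ⟨u, hu, hu1, (hu0 : 0 < u)⟩ :=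
      (hm.and ((hev (s - s₀) (by linarith)).and self_mem_nhdsWithin)).exists
    have := hφ.secant_mono_aux2 ⟨h0, h1.le⟩ hs (show s₀ < s₀ + u by linarith)
      (show s₀ + u < s by linarith)
    rw [hu, add_sub_cancel_left, add_sub_cancel_left, mul_div_cancel_right₀ _ hu0.ne',
      le_div_iff₀ (by linarith)] at this
    linarith

/-- A function with integral subgradients bounded from below is affine near the left end point. -/
theorem affine_near_zero_of_subgradients {g : ℝ → ℝ} {δ : ℝ} (hδ : 0 < δ) {N : ℤ}
    (h : ∀ s₀ ∈ Ico 0 δ, ∃ m : ℤ, N ≤ m ∧ ∀ s ∈ Icc 0 δ, g s₀ + m * (s - s₀) ≤ g s) :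
    ∃ m : ℤ, ∃ η > 0, ∀ s, 0 ≤ s → s ≤ η → g s = g 0 + m * s := by
  choose! m hmN hm using h
  -- Subgradients increase with the point; being integers bounded below, they attain a minimum at
  -- some interior `η`, and are constant on `(0, η]`.
  obtain ⟨k, ⟨η, hη, rfl⟩, hk⟩ := Int.exists_least_of_bdd (P := fun k => ∃ s ∈ Ioo 0 δ, m s = k)
    ⟨N, fun z ⟨s, hs, hz⟩ => hz ▸ hmN s (Ioo_subset_Ico_self hs)⟩
    ⟨_, δ / 2, by constructor <;> linarith, rfl⟩
  have hmono : ∀ s t, 0 < s → s < t → t < δ → m s ≤ m t := by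
    intro s t h0 h1 h2
    have a1 := hm s ⟨h0.le, h1.trans h2⟩ t ⟨(h0.trans h1).le, h2.le⟩
    have a2 := hm t ⟨(h0.trans h1).le, h2⟩ s ⟨h0.le, (h1.trans h2).le⟩
    have : (m s : ℝ) ≤ m t := by
      refine le_of_mul_le_mul_right (a := t - s) ?_ (by linarith)
      linarith
    exact_mod_cast this
  have hconst : ∀ s, 0 < s → s ≤ η → m s = m η := by
    intro s h0 h1
    rcases h1.eq_or_lt with rfl | h1
    · rfl
    · exact le_antisymm (hmono s η h0 h1 hη.2) (hk _ ⟨s, ⟨h0, h1.trans hη.2⟩, rfl⟩)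
  have haff : ∀ s, 0 < s → s ≤ η → g s = g η + m η * (s - η) := by
    intro s h0 h1
    have a1 := hm s ⟨h0.le, h1.trans_lt hη.2⟩ η ⟨hη.1.le, hη.2.le⟩
    have a2 := hm η ⟨hη.1.le, hη.2⟩ s ⟨h0.le, (h1.trans_lt hη.2).le⟩
    rw [hconst s h0 h1] at a1
    linarith
  -- Continuity at `0` is not assumed: the subgradient at `η` bounds `g 0` from below, the one at
  -- `0` bounds it from above in the limit.
  have h0 : g 0 = g η - m η * η := by
    have b1 := hm η ⟨hη.1.le, hη.2⟩ 0 ⟨le_rfl, hδ.le⟩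
    refine le_antisymm ?_ (by linarith)
    have hlim : Tendsto (fun s : ℝ => g η + m η * (s - η) - m 0 * s) (𝓝[>] 0)
        (𝓝 (g η + m η * (0 - η) - m 0 * 0)) :=
      (Continuous.tendsto (by fun_prop) 0).mono_left nhdsWithin_le_nhds
    have := ge_of_tendsto hlim (b := g 0) ?_
    · linarith
    · rw [eventually_nhdsGT_zero_iff]
      refine ⟨η, hη.1, fun s hs hs' => ?_⟩
      have := hm 0 ⟨le_rfl, hδ⟩ s ⟨hs.le, (hs'.trans hη.2).le⟩
      rw [haff s hs hs'.le] at this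
      linarith
  refine ⟨m η, η, hη.1, fun s hs hs' => ?_⟩
  rcases hs.eq_or_lt with rfl | hs
  · simp
  · rw [haff s hs hs', h0]; ring

/-! ### Sections of a divisor: maxima, slope bounds, convexity. -/

namespace WeightedGraph

variable {V E : Type u} {G : WeightedGraph V E}

theorem HasSlope.along_ray {f : G.Point → ℝ} {x : G.Point} {d : E × Bool} {m s δ : ℝ}
    (hs : 0 < s) (hsδ : s < δ) (h : ∀ u, 0 < u → u < δ → f (G.ray x d u) = f x + m * u)
    (hI : G.start x d + dirSign d.2 * s ∈ Ioo 0 (G.len d.1)) :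
    HasSlope f (G.ray x d s) (d.1, !d.2) (-m) := by
  obtain ⟨-, -, -, h'⟩ := isDir_ray hI
  refine eventually_nhdsGT_zero_iff.2 ⟨s, hs, fun u h0 h1 => ?_⟩
  rw [h', h _ (by linarith) (by linarith), h s hs hsδ]; ring

theorem Divisor.apply_le_degree {D : G.Divisor} (h : 0 ≤ D) (x : G.Point) :
    D x ≤ Finsupp.degree D := by
  by_cases hx : D x = 0
  · rw [hx]; exact Divisor.degree_nonneg h
  · exact Finset.single_le_sum (f := D) (fun y _ => h y) (Finsupp.mem_support_iff.2 hx)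

theorem Divisor.eventually_ray_eq_zero (D : G.Divisor) {x : G.Point} {d : E × Bool}
    (hd : G.IsDir x d) : ∀ᶠ s in 𝓝[>] (0 : ℝ), D (G.ray x d s) = 0 := by
  have : ∀ᶠ s in 𝓝[>] (0 : ℝ), ∀ y ∈ D.support, G.ray x d s ≠ y :=
    (Finset.eventually_all _).2 fun y _ => hd.eventually_ne y
  filter_upwards [this] with s hs
  by_contra h
  exact hs _ (Finsupp.mem_support_iff.2 h) rfl

variable [Fintype E]

theorem ord_const (c : ℝ) (x : G.Point) : G.ord (fun _ => c) x = 0 := by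
  rw [ord_eq_sum (m := fun _ => 0) fun d _ => HasSlope.const c]; simp

theorem IsLocAffine.ord_add {f g : G.Point → ℝ} (hf : IsLocAffine f) (hg : IsLocAffine g)
    (x : G.Point) : G.ord (fun y => f y + g y) x = G.ord f x + G.ord g x := by
  choose! m hm using hf x
  choose! n hn using hg x
  rw [ord_eq_sum hm, ord_eq_sum hn, ord_eq_sum fun d hd => (hm d hd).add (hn d hd),
    Finset.sum_add_distrib]

theorem IsLocAffine.ord_neg {f : G.Point → ℝ} (hf : IsLocAffine f) (x : G.Point) :
    G.ord (fun y => -f y) x = -G.ord f x := by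
  choose! m hm using hf x
  rw [ord_eq_sum hm, ord_eq_sum fun d hd => (hm d hd).neg, Finset.sum_neg_distrib]

/-- The rational functions `f` for which `D + div f` is effective. -/
structure IsSection (D : G.Divisor) (f : G.Point → ℝ) : Prop where
  isLocAffine : IsLocAffine f
  effective : ∀ x, 0 ≤ (D x : ℝ) + G.ord f x

namespace IsSection

variable {D : G.Divisor} {f g : G.Point → ℝ}

theorem const (hD : 0 ≤ D) (c : ℝ) : IsSection D (fun _ => c) :=
  ⟨IsLocAffine.const c, fun x => by
    rw [ord_const, add_zero]
    exact_mod_cast hD x⟩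

/-- Where the two functions differ, the maximum is locally one of them; where they agree, its slopes
dominate those of `f`, and so does its order. -/
theorem max (hf : IsSection D f) (hg : IsSection D g) :
    IsSection D (fun y => max (f y) (g y)) := by
  refine ⟨hf.1.max hg.1, fun x => ?_⟩
  choose! m hm using hf.1 x
  choose! n hn using hg.1 x
  rcases lt_trichotomy (f x) (g x) with h | h | h
  · rw [ord_eq_sum fun d hd => (hm d hd).max_of_lt (hn d hd) h, ← ord_eq_sum hn]
    exact hg.2 x
  · rw [ord_eq_sum fun d hd => (hm d hd).max_of_eq (hn d hd) h]
    refine (hf.2 x).trans ?_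
    rw [ord_eq_sum hm]
    gcongr
    exact le_max_left _ _
  · simp_rw [max_comm (f _)]
    rw [ord_eq_sum fun d hd => (hn d hd).max_of_lt (hm d hd) h, ← ord_eq_sum hm]
    exact hf.2 x

theorem add_const (hf : IsSection D f) (c : ℝ) : IsSection D (fun y => f y + c) :=
  ⟨hf.1.add (.const c), fun x => by
    rw [hf.1.ord_add (.const c), ord_const, add_zero]; exact hf.2 x⟩

/-- Truncating `f` below at the value `f x` gives a section whose slopes at `x` are the positive
parts of those of `f`. Its order at `x` is then at least `m`, and at most the degree of `D`, because
the effective divisor it defines has that degree. -/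
theorem slope_le [Fintype V] (hD : 0 ≤ D) (hf : IsSection D f) {x : G.Point} {d : E × Bool}
    (hd : G.IsDir x d) {m : ℝ} (hm : HasSlope f x d m) : m ≤ Finsupp.degree D := by
  have hg := hf.max (const hD (f x))
  obtain ⟨P, hP, h0⟩ := hg.1.exists_div
  choose! k hk using hf.1 x
  have hord := ord_eq_sum fun d hd => (hk d hd).max_of_eq (HasSlope.const (f x)) rfl
  have h1 : (k d : ℝ) ≤ P x := by
    rw [hP, hord]
    refine (le_max_left _ 0).trans ?_
    exact Finset.single_le_sum (f := fun d => Max.max (k d : ℝ) 0) (fun i _ => le_max_right _ _)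
      (G.mem_dirs.2 hd)
  have heff : 0 ≤ D + P := fun y => by
    have := hg.2 y
    rw [← hP y] at this
    exact_mod_cast this
  have h2 := Divisor.apply_le_degree heff x
  rw [map_add, h0, add_zero, Finsupp.add_apply] at h2
  have h3 := hD x
  rw [Finsupp.coe_zero, Pi.zero_apply] at h3
  have h4 : P x ≤ Finsupp.degree D := by linarith
  rw [hm.unique (hk d hd)]
  exact h1.trans (by exact_mod_cast h4)

/-- The upper bound, applied to the reversed direction at a nearby point of the ray. -/
theorem neg_le_slope [Fintype V] (hD : 0 ≤ D) (hf : IsSection D f) {x : G.Point} {d : E × Bool}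
    (hd : G.IsDir x d) {m : ℝ} (hm : HasSlope f x d m) : -((Finsupp.degree D : ℤ) : ℝ) ≤ m := by
  obtain ⟨δ, hδ, h⟩ := eventually_nhdsGT_zero_iff.1 (hm.and hd.eventually_mem_Ioo)
  have h1 := HasSlope.along_ray (s := δ / 2) (δ := δ) (by linarith) (by linarith)
    (fun u hu hu' => (h u hu hu').1) (h _ (by linarith) (by linarith)).2
  have := hf.slope_le hD (isDir_ray (h _ (by linarith) (by linarith)).2).2.1 h1
  linarith

theorem convexOn_ray {x : G.Point} {d : E × Bool} (hf : IsSection D f) {δ : ℝ}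
    (hI : ∀ s ∈ Ioo 0 δ, G.start x d + dirSign d.2 * s ∈ Ioo 0 (G.len d.1))
    (h0 : ∀ s ∈ Ioo 0 δ, D (G.ray x d s) = 0) :
    ConvexOn ℝ (Icc 0 δ) (fun s => f (G.ray x d s)) := by
  refine convexOn_of_slopes_nonneg
    (hf.1.continuous.comp (G.continuous_ray x d)).continuousOn fun s hs => ?_
  obtain ⟨hd1, hd2, hr1, hr2⟩ := isDir_ray (hI s hs)
  choose! m hm using hf.1 (G.ray x d s)
  refine ⟨m d, m (d.1, !d.2), ?_, ?_, ?_⟩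
  · have := hf.2 (G.ray x d s)
    rw [h0 s hs, Int.cast_zero, zero_add, ord_eq_sum hm] at this
    have hx : G.ray x d s = Point.inner d.1 ⟨_, hI s hs⟩ := edge_of_mem G (hI s hs)
    have hsum : ∑ i ∈ G.dirs (G.ray x d s), (m i : ℝ) = m d + m (d.1, !d.2) := by
      rw [hx, dirs, Finset.sum_filter, Fintype.sum_prod_type,
        Finset.sum_eq_single d.1 (fun b _ hb => by simp [IsDir, hb]) (by simp), Fintype.sum_bool]
      obtain ⟨e, b⟩ := d
      cases b <;> simp [IsDir, add_comm]
    rwa [hsum] at this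
  · have := hm d hd1
    simp only [HasSlope, hr1] at this
    exact this
  · have := hm _ hd2
    simp only [HasSlope, hr2] at this
    exact this

/-- The slopes range over a finite set that does not depend on `f`; this is what lets subgradients
survive the passage to a supremum of sections. -/
theorem exists_subgradient [Fintype V] (hD : 0 ≤ D) {x : G.Point} {d : E × Bool}
    (hd : G.IsDir x d) (hf : IsSection D f) {δ : ℝ}
    (hI : ∀ s ∈ Ioo 0 δ, G.start x d + dirSign d.2 * s ∈ Ioo 0 (G.len d.1))
    (h0 : ∀ s ∈ Ioo 0 δ, D (G.ray x d s) = 0) {s₀ : ℝ} (hs₀ : s₀ ∈ Ico 0 δ) :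
    ∃ m ∈ Finset.Icc (-Finsupp.degree D) (Finsupp.degree D),
      ∀ s ∈ Icc 0 δ, f (G.ray x d s₀) + m * (s - s₀) ≤ f (G.ray x d s) := by
  have hconv := hf.convexOn_ray hI h0
  have main : ∀ y, G.IsDir y d → (∀ u, G.ray y d u = G.ray x d (s₀ + u)) → y = G.ray x d s₀ →
      ∃ m ∈ Finset.Icc (-Finsupp.degree D) (Finsupp.degree D),
      ∀ s ∈ Icc 0 δ, f (G.ray x d s₀) + m * (s - s₀) ≤ f (G.ray x d s) := by
    rintro y hy hr rfl
    obtain ⟨m, hm⟩ := hf.1 _ d hy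
    refine ⟨m, Finset.mem_Icc.2 ⟨?_, ?_⟩, hconv.add_mul_sub_le hs₀.1 hs₀.2 ?_⟩
    · exact_mod_cast hf.neg_le_slope hD hy hm
    · exact_mod_cast hf.slope_le hD hy hm
    · simpa only [HasSlope, hr] using hm
  rcases hs₀.1.eq_or_lt with rfl | h
  · exact main x hd (by simp) hd.ray_zero.symm
  · have := isDir_ray (hI s₀ ⟨h, hs₀.2⟩)
    exact main _ this.1 this.2.2.1 rfl

theorem abs_sub_edge_le [Fintype V] (hD : 0 ≤ D) (hf : IsSection D f) (e : E) {s t : ℝ}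
    (hs : 0 ≤ s) (hst : s ≤ t) (ht : t ≤ G.len e) :
    |f (G.edge e t) - f (G.edge e s)| ≤ Finsupp.degree D * (t - s) := by
  have key : ∀ u ∈ Ico s t, ∃ m : ℝ, |m| ≤ Finsupp.degree D ∧
      HasDerivWithinAt (fun u => f (G.edge e u)) m (Ici u) u := by
    intro u hu
    obtain ⟨hd, hr⟩ := isDir_true (hs.trans hu.1) (hu.2.trans_le ht)
    obtain ⟨m, hm⟩ := hf.1 _ _ hd
    refine ⟨m, abs_le.2 ⟨hf.neg_le_slope hD hd hm, hf.slope_le hD hd hm⟩, ?_⟩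
    simp only [HasSlope, hr] at hm
    exact hasDerivWithinAt_Ici_of_eventually hm
  choose! m hm hm' using key
  exact norm_image_sub_le_of_norm_deriv_right_le_segment
    (hf.1.continuous.comp (G.continuous_edge e)).continuousOn hm' hm t ⟨hst, le_rfl⟩

end IsSection


end WeightedGraph

/-! ### The largest section and reduced divisors. -/

namespace WeightedGraph

variable {V E : Type u} {G : WeightedGraph V E}

theorem exists_ray_radius (D : G.Divisor) {x : G.Point} {d : E × Bool} (hd : G.IsDir x d) :
    ∃ δ > 0, (∀ s ∈ Ioo 0 δ, G.start x d + dirSign d.2 * s ∈ Ioo 0 (G.len d.1)) ∧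
      ∀ s ∈ Ioo 0 δ, D (G.ray x d s) = 0 := by
  obtain ⟨δ, hδ, h⟩ :=
    eventually_nhdsGT_zero_iff.1 (hd.eventually_mem_Ioo.and (D.eventually_ray_eq_zero hd))
  exact ⟨δ, hδ, fun s hs => (h s hs.1 hs.2).1, fun s hs => (h s hs.1 hs.2).2⟩

variable [Fintype V] [Fintype E] {D : G.Divisor}

/-- Sections are uniformly Lipschitz along edges, so the set of points where a common bound exists
contains every edge it meets; it is therefore clopen, and it contains `p`. -/
theorem IsSection.bddAbove [ConnectedSpace G.Point] (hD : 0 ≤ D) (p x : G.Point) :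
    ∃ M : ℝ, ∀ f : G.Point → ℝ, IsSection D f → f p = 0 → f x ≤ M := by
  let B : Set G.Point := {x | ∃ M : ℝ, ∀ f : G.Point → ℝ, IsSection D f → f p = 0 → f x ≤ M}
  have hstep : ∀ e s t, s ∈ Icc 0 (G.len e) → t ∈ Icc 0 (G.len e) → G.edge e s ∈ B →
      G.edge e t ∈ B := by
    rintro e s t hs ht ⟨M, hM⟩
    refine ⟨M + Finsupp.degree D * |t - s|, fun f hf h0 => ?_⟩
    have h1 := hM f hf h0
    rcases le_total s t with h | h
    · have := (abs_le.1 (hf.abs_sub_edge_le hD e hs.1 h ht.2)).2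
      rw [abs_of_nonneg (by linarith)]; linarith
    · have := (abs_le.1 (hf.abs_sub_edge_le hD e ht.1 h hs.2)).1
      rw [abs_of_nonpos (by linarith)]; linarith
  have hproj : ∀ e t, ∃ s ∈ Icc 0 (G.len e), G.edge e s = G.edge e t := by
    intro e t
    have hl := G.len_pos e
    rcases le_total t 0 with h | h
    · exact ⟨0, ⟨le_rfl, hl.le⟩, by rw [edge_of_nonpos G h, edge_of_nonpos G le_rfl]⟩
    rcases le_total (G.len e) t with h' | h'
    · exact ⟨_, ⟨hl.le, le_rfl⟩, by rw [edge_of_len_le G h', edge_of_len_le G le_rfl]⟩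
    · exact ⟨t, ⟨h, h'⟩, rfl⟩
  have hstep' : ∀ e s t, G.edge e s ∈ B → G.edge e t ∈ B := by
    intro e s t h
    obtain ⟨s', hs', hs⟩ := hproj e s
    obtain ⟨t', ht', ht⟩ := hproj e t
    rw [← ht]
    exact hstep e s' t' hs' ht' (hs ▸ h)
  have hB : IsClopen B := by
    constructor
    · rw [← isOpen_compl_iff]
      exact G.isOpen_iff.2 fun e => isOpen_iff_mem_nhds.2 fun t ht =>
        univ_mem' fun s hs => ht (hstep' e s t hs)
    · exact G.isOpen_iff.2 fun e => isOpen_iff_mem_nhds.2 fun t ht =>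
        univ_mem' fun s => hstep' e t s ht
  have : B = univ := hB.eq_univ ⟨p, 0, fun f _ h => h.le⟩
  exact (this ▸ mem_univ x : x ∈ B)

/-- Among the sections of an effective divisor that vanish at `p`, there is a largest one. -/
theorem exists_maximal_section [ConnectedSpace G.Point] (hD : 0 ≤ D) (p : G.Point) :
    ∃ F : G.Point → ℝ, IsSection D F ∧ F p = 0 ∧
      ∀ f, IsSection D f → f p = 0 → ∀ x, f x ≤ F x := by
  let I := {f : G.Point → ℝ // IsSection D f ∧ f p = 0}
  have : Nonempty I := ⟨⟨_, IsSection.const hD 0, rfl⟩⟩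
  let F : G.Point → ℝ := fun x => ⨆ f : I, f.1 x
  have hbdd : ∀ x, BddAbove (range fun f : I => f.1 x) := fun x => by
    obtain ⟨M, hM⟩ := IsSection.bddAbove hD p x
    exact ⟨M, by rintro _ ⟨f, rfl⟩; exact hM _ f.2.1 f.2.2⟩
  have hle : ∀ (f : I) x, f.1 x ≤ F x := fun f x => le_ciSup (hbdd x) f
  have happrox : ∀ x (η : ℝ), 0 < η → ∃ f : I, F x - η < f.1 x := fun x η hη =>
    exists_lt_of_lt_ciSup (sub_lt_self _ hη)
  have hslope : ∀ x d, G.IsDir x d → ∃ m : ℤ, ∃ η > 0,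
      ∀ s, 0 ≤ s → s ≤ η → F (G.ray x d s) = F x + m * s := by
    intro x d hd
    obtain ⟨δ, hδ, hI, h0⟩ := exists_ray_radius D hd
    have := affine_near_zero_of_subgradients (g := fun s => F (G.ray x d s)) hδ
      (N := -Finsupp.degree D) fun s₀ hs₀ => ?_
    · simpa only [hd.ray_zero] using this
    -- If each of the finitely many admissible slopes `m` failed to be a subgradient of `F`, at some
    -- `s m`, it would fail by more than a common `η`. A section within `η` of `F` at the base point
    -- has one of these slopes as subgradient, a contradiction.
    · by_contra! hcon
      have hcon' : ∀ m ∈ Finset.Icc (-Finsupp.degree D) (Finsupp.degree D), ∃ s ∈ Icc 0 δ,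
          F (G.ray x d s) < F (G.ray x d s₀) + m * (s - s₀) := fun m hm =>
        hcon m (Finset.mem_Icc.1 hm).1
      choose! s hs hlt using hcon'
      obtain ⟨η, hη, hη'⟩ : ∃ η > 0, ∀ m ∈ Finset.Icc (-Finsupp.degree D) (Finsupp.degree D),
          η < F (G.ray x d s₀) + m * (s m - s₀) - F (G.ray x d (s m)) := by
        have : ∀ᶠ η in 𝓝[>] (0 : ℝ), ∀ m ∈ Finset.Icc (-Finsupp.degree D) (Finsupp.degree D),
            η < F (G.ray x d s₀) + m * (s m - s₀) - F (G.ray x d (s m)) :=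
          (Finset.eventually_all _).2 fun m hm =>
            nhdsWithin_le_nhds (eventually_lt_nhds (by linarith [hlt m hm]))
        obtain ⟨η, h, h'⟩ := (this.and self_mem_nhdsWithin).exists
        exact ⟨η, h', h⟩
      obtain ⟨f, hf⟩ := happrox (G.ray x d s₀) η hη
      obtain ⟨m, hm, hsub⟩ := IsSection.exists_subgradient hD hd f.2.1 hI h0 hs₀
      have h1 := hsub (s m) (hs m hm)
      have h2 := hle f (G.ray x d (s m))
      have h3 := hη' m hm
      linarith
  have hF : IsLocAffine F := fun x d hd => by
    obtain ⟨m, η, hη, h⟩ := hslope x d hd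
    exact ⟨m, eventually_nhdsGT_zero_iff.2 ⟨η, hη, fun s h0 h1 => h s h0.le h1.le⟩⟩
  refine ⟨F, ⟨hF, fun x => ?_⟩, ?_, fun f hf h0 => hle ⟨f, hf, h0⟩⟩
  · choose! M η hη hM using hslope x
    have hMs : ∀ d, G.IsDir x d → HasSlope F x d (M d) := fun d hd =>
      eventually_nhdsGT_zero_iff.2 ⟨η d, hη d hd, fun s h0 h1 => hM d hd s h0.le h1.le⟩
    have hrad : ∀ d, G.IsDir x d → ∃ δ > 0, δ ≤ η d ∧
        (∀ s ∈ Ioo 0 δ, G.start x d + dirSign d.2 * s ∈ Ioo 0 (G.len d.1)) ∧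
        ∀ s ∈ Ioo 0 δ, D (G.ray x d s) = 0 := fun d hd => by
      obtain ⟨δ, hδ, hI, h0⟩ := exists_ray_radius D hd
      refine ⟨min δ (η d), lt_min hδ (hη d hd), min_le_right _ _, fun s hs => hI s ?_,
        fun s hs => h0 s ?_⟩ <;> exact ⟨hs.1, hs.2.trans_le (min_le_left _ _)⟩
    choose! δ hδ hδη hI h0 using hrad
    -- A section `f` within `κ` of `F` at `x` has slopes less than those of `F` plus `1`, because it
    -- is convex on `[0, δ d]` and stays below `F`. By integrality its slopes are at most those of
    -- `F`, so the order of `F` at `x` is at least that of `f`.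
    obtain ⟨κ, hκ, hκ'⟩ : ∃ κ > 0, ∀ d ∈ G.dirs x, κ < δ d := by
      have : ∀ᶠ κ in 𝓝[>] (0 : ℝ), ∀ d ∈ G.dirs x, κ < δ d :=
        (Finset.eventually_all _).2 fun d hd =>
          nhdsWithin_le_nhds (eventually_lt_nhds (hδ d (G.mem_dirs.1 hd)))
      obtain ⟨κ, h, h'⟩ := (this.and self_mem_nhdsWithin).exists
      exact ⟨κ, h', h⟩
    obtain ⟨f, hf⟩ := happrox x κ hκ
    choose! m hm using f.2.1.1 x
    have hcomp : ∀ d, G.IsDir x d → m d ≤ M d := by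
      intro d hd
      have hδd := hδ d hd
      have hsub := (f.2.1.convexOn_ray (hI d hd) (h0 d hd)).add_mul_sub_le (m := m d) le_rfl hδd
        (by simpa only [HasSlope, zero_add, hd.ray_zero] using hm d hd) (δ d)
        ⟨hδd.le, le_rfl⟩
      rw [hd.ray_zero, sub_zero] at hsub
      have h1 := hle f (G.ray x d (δ d))
      rw [hM d hd (δ d) hδd.le (hδη d hd)] at h1
      have h2 := hκ' d (G.mem_dirs.2 hd)
      have h3 : (m d : ℝ) < M d + 1 := by
        refine lt_of_mul_lt_mul_right (a := δ d) ?_ hδd.le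
        linarith
      have : m d < M d + 1 := by exact_mod_cast h3
      omega
    refine (f.2.1.2 x).trans ?_
    rw [ord_eq_sum hm, ord_eq_sum hMs]
    gcongr with d hd
    exact hcomp d (G.mem_dirs.1 hd)
  · have : ∀ f : I, f.1 p = 0 := fun f => f.2.2
    simp [F, this]

/-- The divisor of the largest section: the reduced divisor of a linear system at `p`. -/
theorem exists_reduced_divisor [ConnectedSpace G.Point] (h : (G.linearSystem D).Nonempty)
    (p : G.Point) : ∃ D' : G.Divisor, 0 ≤ D' ∧
      (∀ F : G.Divisor, (G.linearSystem (D - F)).Nonempty ↔ (G.linearSystem (D' - F)).Nonempty) ∧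
      ∀ f, IsSection D' f → f p = 0 → ∀ x, f x ≤ 0 := by
  have transfer : ∀ (D D' : G.Divisor) (g : G.Point → ℝ), IsLocAffine g →
      (∀ x, (D' x : ℝ) = D x + G.ord g x) → ∀ F : G.Divisor,
      (G.linearSystem (D - F)).Nonempty → (G.linearSystem (D' - F)).Nonempty := by
    intro D D' g hg h F hF
    rw [linearSystem_nonempty_iff] at hF ⊢
    obtain ⟨f, hf, hF⟩ := hF
    refine ⟨_, hf.add hg.neg, fun x => (hF x).trans_eq ?_⟩
    rw [hf.ord_add hg.neg, hg.ord_neg, Finsupp.sub_apply, Finsupp.sub_apply]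
    push_cast
    rw [h x]; ring
  obtain ⟨D₁, hD₁, g₁, hg₁, h₁⟩ := h
  obtain ⟨g₂, hg₂, hp, hmax⟩ := exists_maximal_section hD₁ p
  obtain ⟨P, hP, -⟩ := hg₂.1.exists_div
  have h₁' := hg₁.isLocAffine
  have hD' : ∀ x, ((D₁ + P) x : ℝ) = D₁ x + G.ord g₂ x := fun x => by
    rw [Finsupp.add_apply, ← hP]; push_cast; rfl
  refine ⟨D₁ + P, fun x => ?_, fun F => ⟨fun h => ?_, fun h => ?_⟩, fun f hf h0 x => ?_⟩
  · have := hg₂.2 x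
    rw [← hD' x] at this
    exact_mod_cast this
  · exact transfer _ _ g₂ hg₂.1 hD' F (transfer _ _ g₁ h₁' h₁ F h)
  · refine transfer _ _ _ h₁'.neg (fun x => ?_) F (transfer _ D₁ _ hg₂.1.neg (fun x => ?_) F h)
    · rw [h₁'.ord_neg, h₁ x]; ring
    · rw [hg₂.1.ord_neg, hD' x]; ring
  -- Adding `g₂` turns sections of the new divisor into sections of `D₁`, where `g₂` is the largest.
  · have hs : IsSection D₁ (fun y => g₂ y + f y) := ⟨hg₂.1.add hf.1, fun y => by
      have := hf.2 y
      rw [hg₂.1.ord_add hf.1, ← add_assoc, ← hD' y]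
      exact this⟩
    have := hmax _ hs (by simp [hp, h0]) x
    linarith

end WeightedGraph

/-! ### Lifts of circle-valued maps and winding of singular 1-simplices. -/

section Winding

open unitInterval

/-- A map from a star-shaped (here: standard simplex) space to the circle lifts to `ℝ`. -/
theorem stdSimplex.exists_lift_addCircle {n : ℕ}
    (g : C(stdSimplex ℝ (Fin (n + 1)), AddCircle (1 : ℝ))) :
    ∃ F : C(stdSimplex ℝ (Fin (n + 1)), ℝ), ∀ x, (F x : AddCircle (1 : ℝ)) = g x := by
  have cov := AddCircle.isCoveringMap_coe (1 : ℝ)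
  let c : stdSimplex ℝ (Fin (n + 1)) := Classical.arbitrary _
  -- The straight-line contraction to `c` is a homotopy from a constant map, which lifts, to `g`;
  -- its lift at time `1` lifts `g`.
  let H : C(I × stdSimplex ℝ (Fin (n + 1)), AddCircle (1 : ℝ)) :=
    g.comp ⟨fun q => ⟨(1 - (q.1 : ℝ)) • (c : Fin (n + 1) → ℝ) + (q.1 : ℝ) • (q.2 : Fin (n + 1) → ℝ),
      convex_stdSimplex ℝ _ c.2 q.2.2 (by linarith [q.1.2.2]) q.1.2.1 (by ring)⟩, by fun_prop⟩
  obtain ⟨r, hr⟩ := QuotientAddGroup.mk_surjective (g c)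
  let f : C(stdSimplex ℝ (Fin (n + 1)), ℝ) := ContinuousMap.const _ r
  have H0 : ∀ a, H (0, a) = (f a : AddCircle (1 : ℝ)) := by
    intro a
    refine Eq.trans ?_ hr.symm
    change g _ = g c
    congr 1
    apply Subtype.ext
    simp
    rfl
  refine ⟨(cov.liftHomotopy H f H0).comp ⟨fun a => (1, a), by fun_prop⟩, fun x => ?_⟩
  have := congrFun (cov.liftHomotopy_lifts H f H0) (1, x)
  refine this.trans ?_
  change g _ = g x
  congr 1
  apply Subtype.ext
  simp
  rfl

/-- Two lifts to `ℝ` of a map from a connected space to the circle differ by a constant. -/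
theorem lift_addCircle_sub_eq {X : Type*} [TopologicalSpace X] [PreconnectedSpace X]
    (F F' : C(X, ℝ)) (h : ∀ x, (F x : AddCircle (1 : ℝ)) = F' x) (x y : X) :
    F x - F y = F' x - F' y := by
  have cov := AddCircle.isCoveringMap_coe (1 : ℝ)
  have key : (fun z => F z) = fun z => F' z + (F x - F' x) := by
    refine cov.eq_of_comp_eq F.continuous (by fun_prop) ?_ x (by ring)
    ext z
    have hx : ((F x - F' x : ℝ) : AddCircle (1 : ℝ)) = 0 := by
      rw [AddCircle.coe_sub, h x, sub_self]
    change (F z : AddCircle (1 : ℝ)) = ((F' z + (F x - F' x) : ℝ) : AddCircle (1 : ℝ))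
    rw [AddCircle.coe_add, hx, add_zero, h z]
  have := congrFun key y
  linarith

/-- The difference of the values at the end points of a lift of a map from the standard 1-simplex
to the circle. -/
noncomputable def winding (g : C(stdSimplex ℝ (Fin 2), AddCircle (1 : ℝ))) : ℝ :=
  (stdSimplex.exists_lift_addCircle g).choose (stdSimplex.vertex 1) -
    (stdSimplex.exists_lift_addCircle g).choose (stdSimplex.vertex 0)

theorem winding_eq (g : C(stdSimplex ℝ (Fin 2), AddCircle (1 : ℝ)))
    (F : C(stdSimplex ℝ (Fin 2), ℝ)) (hF : ∀ x, (F x : AddCircle (1 : ℝ)) = g x) :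
    winding g = F (stdSimplex.vertex 1) - F (stdSimplex.vertex 0) :=
  lift_addCircle_sub_eq _ _ (fun x => by
    rw [(stdSimplex.exists_lift_addCircle g).choose_spec x, hF x]) _ _

end Winding

/-! ### The winding cocycle on singular homology. -/

section Homology

open CategoryTheory Limits Simplicial AlgebraicTopology

/-- The homomorphism `ℤ → ℝ` with given value at `1`. -/
noncomputable def intToReal (r : ℝ) :
    ModuleCat.of ℤ (ULift.{u} ℤ) ⟶ ModuleCat.of ℤ (ULift.{u} ℝ) :=
  ModuleCat.ofHom
    { toFun := fun n => ⟨n.down • r⟩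
      map_add' := fun a b => by ext; simp [add_mul]
      map_smul' := fun a b => by ext; simp [mul_assoc] }

theorem intToReal_add (r s : ℝ) : intToReal.{u} (r + s) = intToReal r + intToReal s := by
  ext n
  simp [intToReal]

theorem intToReal_neg (r : ℝ) : intToReal.{u} (-r) = -intToReal r := by
  ext n
  simp [intToReal]

variable {K : Type u} [TopologicalSpace K] (θ : C(K, AddCircle (1 : ℝ)))

/-- The singular 1-cochain that assigns to a path the increment of a lift of its image in the
circle. -/
noncomputable def windingCochain :
    ((TopCat.toSSet.obj (TopCat.of K)).chainComplex (ModuleCat.of ℤ (ULift.{u} ℤ))).X 1 ⟶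
      ModuleCat.of ℤ (ULift.{u} ℝ) :=
  Sigma.desc fun x => intToReal (winding (θ.comp (TopCat.toSSetObjEquiv (TopCat.of K) _ x)))

theorem ι_windingCochain (x : (TopCat.toSSet.obj (TopCat.of K)) _⦋1⦌) :
    (TopCat.toSSet.obj (TopCat.of K)).ιChainComplex x ≫ windingCochain θ =
      intToReal (winding (θ.comp (TopCat.toSSetObjEquiv (TopCat.of K) _ x))) :=
  Sigma.ι_desc _ _

theorem toSSetObjEquiv_δ {n : ℕ} (x : (TopCat.toSSet.obj (TopCat.of K)) _⦋n + 1⦌)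
    (i : Fin (n + 2)) (y : stdSimplex ℝ (Fin (n + 1))) :
    TopCat.toSSetObjEquiv (TopCat.of K) _ ((TopCat.toSSet.obj (TopCat.of K)).δ i x) y =
      TopCat.toSSetObjEquiv (TopCat.of K) _ x (stdSimplex.map (SimplexCategory.δ i) y) :=
  rfl

/-- One lift of the whole 2-simplex computes the winding of its three faces, and the alternating sum
of differences of vertex values vanishes. -/
theorem d_windingCochain :
    ((TopCat.toSSet.obj (TopCat.of K)).chainComplex (ModuleCat.of ℤ (ULift.{u} ℤ))).d 2 1 ≫
      windingCochain θ = 0 := by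
  apply SSet.chainComplex_hom_ext
  intro x
  rw [SSet.ιChainComplex_d_assoc]
  obtain ⟨F, hF⟩ := stdSimplex.exists_lift_addCircle
    (θ.comp (TopCat.toSSetObjEquiv (TopCat.of K) _ x))
  have hw : ∀ i : Fin 3, winding (θ.comp (TopCat.toSSetObjEquiv (TopCat.of K) _
      ((TopCat.toSSet.obj (TopCat.of K)).δ i x))) =
      F (stdSimplex.vertex (i.succAbove 1)) - F (stdSimplex.vertex (i.succAbove 0)) := by
    intro i
    rw [winding_eq _ (F.comp ⟨_, stdSimplex.continuous_map (SimplexCategory.δ i)⟩) ]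
    · change F (stdSimplex.map _ (stdSimplex.vertex 1)) -
        F (stdSimplex.map _ (stdSimplex.vertex 0)) = _
      rw [stdSimplex.map_vertex, stdSimplex.map_vertex]
      rfl
    · intro y
      exact hF _
  have s01 : (0 : Fin 3).succAbove (1 : Fin 2) = 2 := rfl
  have s00 : (0 : Fin 3).succAbove (0 : Fin 2) = 1 := rfl
  have s11 : (1 : Fin 3).succAbove (1 : Fin 2) = 2 := rfl
  have s10 : (1 : Fin 3).succAbove (0 : Fin 2) = 0 := rfl
  have s21 : (2 : Fin 3).succAbove (1 : Fin 2) = 1 := rfl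
  have s20 : (2 : Fin 3).succAbove (0 : Fin 2) = 0 := rfl
  rw [Preadditive.sum_comp]
  refine (Fin.sum_univ_three _).trans ?_
  simp only [Preadditive.zsmul_comp, ι_windingCochain, hw]
  simp only [s00, s01, s10, s11, s20, s21, sub_eq_add_neg, intToReal_add, intToReal_neg]
  simp
  abel


/-- A loop on which a circle-valued map has a nonzero winding number is a homology class of
infinite order. -/
theorem firstBetti_ne_zero_of_loop (γ : C(unitInterval, K)) (hγ : γ 0 = γ 1)
    (F : C(unitInterval, ℝ)) (hF : ∀ t, (F t : AddCircle (1 : ℝ)) = θ (γ t)) (hne : F 0 ≠ F 1) :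
    firstBetti K ≠ 0 := by
  let C := (TopCat.toSSet.obj (TopCat.of K)).chainComplex (ModuleCat.of ℤ (ULift.{u} ℤ))
  let e := stdSimplexHomeomorphUnitInterval
  let x : (TopCat.toSSet.obj (TopCat.of K)) _⦋1⦌ :=
    (TopCat.toSSetObjEquiv (TopCat.of K) _).symm (γ.comp ⟨e, e.continuous⟩)
  let ι := (TopCat.toSSet.obj (TopCat.of K)).ιChainComplex (R := ModuleCat.of ℤ (ULift.{u} ℤ)) x
  have hx : TopCat.toSSetObjEquiv (TopCat.of K) _ x = γ.comp ⟨e, e.continuous⟩ :=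
    Equiv.apply_symm_apply _ _
  have e0 : e (stdSimplex.vertex 0) = 0 := stdSimplexHomeomorphUnitInterval_zero
  have e1 : e (stdSimplex.vertex 1) = 1 := stdSimplexHomeomorphUnitInterval_one
  -- The two ends of the loop agree, so this single 1-simplex is already a cycle.
  have hd : ι ≫ C.d 1 0 = 0 := by
    rw [SSet.ιChainComplex_d]
    have : (TopCat.toSSet.obj (TopCat.of K)).δ 0 x = (TopCat.toSSet.obj (TopCat.of K)).δ 1 x := by
      apply (TopCat.toSSetObjEquiv (TopCat.of K) _).injective
      ext y
      rw [toSSetObjEquiv_δ, toSSetObjEquiv_δ, hx]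
      rw [Subsingleton.elim y (stdSimplex.vertex 0), stdSimplex.map_vertex, stdSimplex.map_vertex]
      change γ (e (stdSimplex.vertex 1)) = γ (e (stdSimplex.vertex 0))
      rw [e0, e1, hγ]
    simp [this]
  have hw : ι ≫ windingCochain θ = intToReal (F 1 - F 0) := by
    rw [ι_windingCochain, hx, winding_eq _ (F.comp ⟨e, e.continuous⟩)]
    · simp [e0, e1]
    · intro y
      exact hF _
  intro h0
  have tors := rank_eq_zero_iff.1 h0
  let z := C.liftCycles ι 0 (by simp) hd ≫ C.homologyπ 1
  -- The cocycle induces a map from homology to the torsion-free group `ℝ`, with the nonzero value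
  -- `F 1 - F 0` on the class of the loop; rank zero would make that class torsion.
  let φ : C.homology 1 ⟶ ModuleCat.of ℤ (ULift.{u} ℝ) :=
    C.homologyι 1 ≫ C.descOpcycles (windingCochain θ) 2 (by simp) (d_windingCochain θ)
  have hzφ : z ≫ φ = intToReal (F 1 - F 0) := by
    simp [z, φ, hw]
  obtain ⟨a, ha, h⟩ := tors (z.hom ⟨1⟩)
  have h1 : a • φ.hom (z.hom ⟨1⟩) = 0 := by
    have := φ.hom.map_smul a (z.hom ⟨1⟩)
    rw [← this]
    exact (congrArg φ.hom h).trans (map_zero _)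
  have h2 : φ.hom (z.hom ⟨1⟩) = (⟨F 1 - F 0⟩ : ULift.{u} ℝ) := by
    have := congrArg (fun k => k.hom (⟨1⟩ : ULift.{u} ℤ)) hzφ
    simpa [intToReal] using this
  rw [h2] at h1
  have h3 := congrArg ULift.down h1
  simp [ha, sub_eq_zero] at h3
  exact hne h3.symm

end Homology

/-! ### Homologically nontrivial loops in the graph. -/

namespace WeightedGraph

variable {V E : Type u} {G : WeightedGraph V E}

theorem continuousOn_of_tendsto_ray {X : Type*} [TopologicalSpace X] {f : G.Point → X}
    {U : Set G.Point} (hU : IsOpen U) (h : ∀ x ∈ U, ∀ d, G.IsDir x d →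
      Tendsto (fun s => f (G.ray x d s)) (𝓝[>] (0 : ℝ)) (𝓝 (f x))) : ContinuousOn f U := by
  refine (continuousOn_open_iff hU).2 fun N hN => ?_
  refine isOpen_of_eventually_ray fun x hx d hd => ?_
  exact (hd.eventually_mem hU hx.1).and (h x hx.1 d hd (hN.mem_nhds hx.2))

theorem IsDir.edge_start {x : G.Point} {d : E × Bool} (hd : G.IsDir x d) :
    G.edge d.1 (G.start x d) = x := by
  have := hd.ray_zero
  rwa [ray, mul_zero, add_zero] at this

theorem dirSign_mul_self (b : Bool) : dirSign b * dirSign b = 1 := by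
  cases b <;> simp [dirSign]

theorem start_vertex {v : V} {d : E × Bool} :
    G.start (Point.vertex v) d ≤ 0 ∨ G.len d.1 ≤ G.start (Point.vertex v) d := by
  obtain ⟨e, b⟩ := d
  cases b <;> simp [start]

/-- A continuous function on `[0, δ]`, constant near both ends, increasing from `0` to `1`. -/
noncomputable def ramp (δ c : ℝ) : ℝ := max 0 (min 1 (3 * c / δ - 1))

theorem continuous_ramp (δ : ℝ) : Continuous (ramp δ) := by
  unfold ramp; fun_prop

theorem ramp_of_le {δ c : ℝ} (hδ : 0 < δ) (h : c ≤ 0) : ramp δ c = 0 := by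
  have : 3 * c / δ ≤ 0 := div_nonpos_of_nonpos_of_nonneg (by linarith) hδ.le
  exact max_eq_left ((min_le_right _ _).trans (by linarith))

theorem ramp_of_ge {δ c : ℝ} (hδ : 0 < δ) (h : δ ≤ c) : ramp δ c = 1 := by
  have : 2 ≤ 3 * c / δ := by rw [le_div_iff₀ hδ]; linarith
  rw [ramp, min_eq_left (by linarith), max_eq_right zero_le_one]

theorem Path.lift_trans {X : Type*} [TopologicalSpace X] {θ : X → AddCircle (1 : ℝ)} {x y z : X}
    {a b c : ℝ} {γ : Path x y} {γ' : Path y z} {Γ : Path a b} {Γ' : Path b c}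
    (h : ∀ t, (Γ t : AddCircle (1 : ℝ)) = θ (γ t)) (h' : ∀ t, (Γ' t : AddCircle (1 : ℝ)) = θ (γ' t))
    (t : unitInterval) : ((Γ.trans Γ') t : AddCircle (1 : ℝ)) = θ ((γ.trans γ') t) := by
  rw [Path.trans_apply, Path.trans_apply]
  split_ifs
  · exact h _
  · exact h' _

/-- Two directions at `v` that lead into a connected open set `U` not containing `v` give a
homologically nontrivial loop in `U ∪ {v}`. -/
theorem firstBetti_ne_zero_of_two_dirs {U K : Set G.Point} (hU : IsOpen U) (hconn : IsConnected U)
    {v : G.Point} (hv : v ∉ U) (hUK : U ⊆ K) (hvK : v ∈ K) {d₁ d₂ : E × Bool} (hne : d₁ ≠ d₂)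
    (hd₁ : G.IsDir v d₁) (hd₂ : G.IsDir v d₂) (h₁ : ∀ᶠ s in 𝓝[>] (0 : ℝ), G.ray v d₁ s ∈ U)
    (h₂ : ∀ᶠ s in 𝓝[>] (0 : ℝ), G.ray v d₂ s ∈ U) : firstBetti K ≠ 0 := by
  classical
  -- The condition `2 * δ ≤ len` keeps the two initial segments apart when `d₁` and `d₂` are the two
  -- ends of one loop edge.
  obtain ⟨δ, hδ, hlen, hδ'⟩ : ∃ δ, 0 < δ ∧ 2 * δ ≤ G.len d₁.1 ∧ ∀ s, 0 < s → s ≤ δ →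
      (G.start v d₁ + dirSign d₁.2 * s ∈ Ioo 0 (G.len d₁.1) ∧ G.ray v d₁ s ∈ U) ∧
      (G.start v d₂ + dirSign d₂.2 * s ∈ Ioo 0 (G.len d₂.1) ∧ G.ray v d₂ s ∈ U) := by
    obtain ⟨δ, hδ, h⟩ := eventually_nhdsGT_zero_iff.1
      ((hd₁.eventually_mem_Ioo.and h₁).and (hd₂.eventually_mem_Ioo.and h₂))
    have hl := G.len_pos d₁.1
    exact ⟨min (δ / 2) (G.len d₁.1 / 2), by positivity,
      by linarith [min_le_right (δ / 2) (G.len d₁.1 / 2)],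
      fun s h0 h1 => h s h0 (by linarith [min_le_left (δ / 2) (G.len d₁.1 / 2)])⟩
  set e := d₁.1 with he
  set σ := dirSign d₁.2 with hσ
  set a := G.start v d₁ with ha
  have hσσ : σ * σ = 1 := dirSign_mul_self _
  let q : ℝ → ℝ := fun t => σ * (t - a)
  have hqc : Continuous q := by fun_prop
  have hq : ∀ s, q (a + σ * s) = s := fun s => by
    simp only [q]
    linear_combination s * hσσ
  have hq' : ∀ t, a + σ * q t = t := fun t => by
    simp only [q]
    linear_combination (t - a) * hσσ
  have hout : ∀ t, t ≤ 0 ∨ G.len e ≤ t → q t ≤ 0 ∨ δ ≤ q t := by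
    intro t ht
    by_contra! hcon
    have := (hδ' (q t) hcon.1 hcon.2.le).1.1
    rw [hq'] at this
    rcases ht with h | h
    · linarith [this.1]
    · linarith [this.2]
  -- In the parameter `q`, the distance from `v` in direction `d₁`, this lifts the ramp modulo `1`
  -- and vanishes outside `(0, δ)`; its only jump is at `q = 0`.
  let lam : ℝ → ℝ := fun t => if 0 < q t then ramp δ (q t) - 1 else 0
  have hlamout : ∀ t, q t ≤ 0 ∨ δ ≤ q t → lam t = 0 := by
    intro t ht
    rcases ht with h | h
    · simp only [lam, if_neg (not_lt.2 h)]
    · simp only [lam, if_pos (hδ.trans_le h), ramp_of_ge hδ h, sub_self]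
  have hcoe : ∀ t, ((lam t : ℝ) : AddCircle (1 : ℝ)) = (ramp δ (q t) : ℝ) := by
    intro t
    by_cases h : 0 < q t
    · simp only [lam, if_pos h]
      rw [AddCircle.coe_sub, AddCircle.coe_period, sub_zero]
    · simp only [lam, if_neg h, ramp_of_le hδ (not_lt.1 h)]
  have hlamc : ∀ t, q t ≠ 0 → ContinuousAt lam t := by
    intro t ht
    rcases lt_or_gt_of_ne ht with h | h
    · refine (continuousAt_const (y := (0 : ℝ))).congr ?_
      filter_upwards [(hqc.tendsto t).eventually_lt_const h] with u hu
      simp only [lam, if_neg (not_lt.2 hu.le)]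
    · have : ContinuousAt (fun u => ramp δ (q u) - 1) t :=
        (((continuous_ramp δ).comp hqc).sub continuous_const).continuousAt
      refine this.congr ?_
      filter_upwards [(hqc.tendsto t).eventually_const_lt h] with u hu
      simp only [lam, if_pos hu]
  -- `Θ` wraps the initial segment of `d₁` once around the circle and sends the rest of the graph to
  -- `0`. Its real lift `ℓ` is discontinuous only at `v`, hence continuous on `U`.
  let Θ : G.Point → AddCircle (1 : ℝ) := fun x => match x with
    | Point.vertex _ => 0
    | Point.inner e' t => if e' = e then (ramp δ (q t) : ℝ) else 0
  let ℓ : G.Point → ℝ := fun x => match x with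
    | Point.vertex _ => 0
    | Point.inner e' t => if e' = e then lam t else 0
  have hℓΘ : ∀ x, (ℓ x : AddCircle (1 : ℝ)) = Θ x := by
    rintro (w | ⟨e', t⟩)
    · rfl
    · simp only [ℓ, Θ]
      split_ifs
      · exact hcoe t
      · rfl
  have hΘray : ∀ x (d : E × Bool), G.IsDir x d → d.1 = e → ∀ᶠ s in 𝓝[>] (0 : ℝ),
      Θ (G.ray x d s) = (ramp δ (q (G.start x d + dirSign d.2 * s)) : ℝ) ∧
      ℓ (G.ray x d s) = lam (G.start x d + dirSign d.2 * s) := by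
    intro x d hd hde
    filter_upwards [hd.eventually_mem_Ioo] with s hs
    simp only [ray, edge_of_mem G hs, Θ, ℓ, if_pos hde, and_self]
  have hbase : ∀ x (d : E × Bool), G.IsDir x d → d.1 = e →
      Θ x = (ramp δ (q (G.start x d)) : ℝ) ∧ ℓ x = lam (G.start x d) := by
    rintro (w | ⟨e', t⟩) d hd hde
    · have h := hlamout _ (hout _ (hde ▸ start_vertex (G := G) (v := w) (d := d)))
      rw [← hcoe, h]
      exact ⟨rfl, rfl⟩
    · have : e' = e := Eq.trans (Eq.symm hd) hde
      simp only [Θ, ℓ, if_pos this, start, and_self]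
  have hother : ∀ x (d : E × Bool), G.IsDir x d → d.1 ≠ e → (Θ x = 0 ∧ ℓ x = 0) ∧
      ∀ᶠ s in 𝓝[>] (0 : ℝ), Θ (G.ray x d s) = 0 ∧ ℓ (G.ray x d s) = 0 := by
    intro x d hd hde
    constructor
    · rcases x with w | ⟨e', t⟩
      · exact ⟨rfl, rfl⟩
      · have : e' ≠ e := fun h => hde (Eq.trans hd h)
        simp only [Θ, ℓ, if_neg this, and_self]
    · filter_upwards [hd.eventually_mem_Ioo] with s hs
      simp only [ray, edge_of_mem G hs, Θ, ℓ, if_neg hde, and_self]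
  have hstart : ∀ x (d : E × Bool), Tendsto (fun s : ℝ => G.start x d + dirSign d.2 * s) (𝓝[>] 0)
      (𝓝 (G.start x d)) := by
    intro x d
    have : Tendsto (fun s : ℝ => G.start x d + dirSign d.2 * s) (𝓝 0)
      (𝓝 (G.start x d + dirSign d.2 * 0)) := Continuous.tendsto (by fun_prop) 0
    rw [mul_zero, add_zero] at this
    exact this.mono_left nhdsWithin_le_nhds
  have hΘc : Continuous Θ := by
    refine continuous_of_tendsto_ray fun x d hd => ?_
    by_cases hde : d.1 = e
    · rw [(hbase x d hd hde).1]
      have hc : Continuous fun t => ((ramp δ (q t) : ℝ) : AddCircle (1 : ℝ)) :=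
        (AddCircle.continuous_mk' 1).comp ((continuous_ramp δ).comp hqc)
      refine ((hc.tendsto _).comp (hstart x d)).congr' ?_
      filter_upwards [hΘray x d hd hde] with s hs
      exact hs.1.symm
    · obtain ⟨h, h'⟩ := hother x d hd hde
      rw [h.1]
      exact tendsto_const_nhds.congr' (h'.mono fun s hs => hs.1.symm)
  have hℓc : ContinuousOn ℓ U := by
    refine continuousOn_of_tendsto_ray hU fun x hx d hd => ?_
    by_cases hde : d.1 = e
    · rw [(hbase x d hd hde).2]
      have hq0 : q (G.start x d) ≠ 0 := by
        intro h0
        have h1 := hq' (G.start x d)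
        rw [h0, mul_zero, add_zero] at h1
        have h2 := hd.edge_start
        rw [hde, ← h1, ha, he, hd₁.edge_start] at h2
        exact hv (h2 ▸ hx)
      refine ((hlamc _ hq0).tendsto.comp (hstart x d)).congr' ?_
      filter_upwards [hΘray x d hd hde] with s hs
      exact hs.2.symm
    · obtain ⟨h, h'⟩ := hother x d hd hde
      rw [h.2]
      exact tendsto_const_nhds.congr' (h'.mono fun s hs => hs.2.symm)
  have hray₁ : ∀ s, 0 < s → s ≤ δ → Θ (G.ray v d₁ s) = (ramp δ s : ℝ) ∧
      ℓ (G.ray v d₁ s) = ramp δ s - 1 := by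
    intro s h0 h1
    have := (hδ' s h0 h1).1.1
    have hx : G.ray v d₁ s = Point.inner e ⟨_, this⟩ := edge_of_mem G this
    rw [hx]
    simp only [Θ, ℓ, if_true, lam]
    rw [hq, if_pos h0]
    exact ⟨rfl, rfl⟩
  have hΘv : Θ v = 0 := by
    rw [(hbase v d₁ hd₁ rfl).1]
    have : q a = 0 := by simp [q]
    rw [← ha, this, ramp_of_le hδ le_rfl]
    rfl
  have hray₂ : ∀ s, 0 < s → s ≤ δ → ℓ (G.ray v d₂ s) = 0 := by
    intro s h0 h1
    have hI := (hδ' s h0 h1).2.1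
    have hx : G.ray v d₂ s = Point.inner d₂.1 ⟨_, hI⟩ := edge_of_mem G hI
    rw [hx]
    by_cases hde : d₂.1 = e
    · simp only [ℓ, if_pos hde]
      apply hlamout
      have hb : d₂.2 ≠ d₁.2 := fun h => hne (Prod.ext hde.symm h.symm)
      have hσ₂ : dirSign d₂.2 = -σ := by
        rw [hσ]
        revert hb
        cases d₂.2 <;> cases d₁.2 <;> simp [dirSign]
      rw [hσ₂]
      have hqs : q (G.start v d₂ + -σ * s) = σ * (G.start v d₂ - a) - s := by
        simp only [q]
        linear_combination (-s) * hσσ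
      rw [hqs]
      rcases v with w | ⟨e', t⟩
      · right
        have : σ * (G.start (Point.vertex w) d₂ - a) = G.len e := by
          rw [ha, hσ]
          simp only [start, hde]
          revert hb
          cases d₂.2 <;> cases d₁.2 <;> simp [dirSign, he]
        rw [this]; linarith
      · left
        have : G.start (Point.inner e' t) d₂ = a := rfl
        rw [this, sub_self, mul_zero]; linarith
    · simp only [ℓ, if_neg hde]
  have hp₁ := (hδ' δ hδ le_rfl).1.2
  have hp₂ := (hδ' δ hδ le_rfl).2.2
  have hpath : IsPathConnected U := hU.isConnected_iff_isPathConnected.1 hconn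
  obtain ⟨γ, hγ⟩ := hpath.joinedIn _ hp₁ _ hp₂
  have hmem : ∀ (d : E × Bool), G.IsDir v d → (∀ s, 0 < s → s ≤ δ → G.ray v d s ∈ U) →
      ∀ s, 0 ≤ s → s ≤ δ → G.ray v d s ∈ K := by
    intro d hd h s h0 h1
    rcases h0.eq_or_lt with rfl | h0
    · rw [hd.ray_zero]; exact hvK
    · exact hUK (h s h0 h1)
  let γ₁ : Path (⟨v, hvK⟩ : K) ⟨_, hUK hp₁⟩ :=
    { toFun := fun t => ⟨G.ray v d₁ (δ * t), hmem d₁ hd₁ (fun s h h' => (hδ' s h h').1.2) _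
        (mul_nonneg hδ.le t.2.1) (mul_le_of_le_one_right hδ.le t.2.2)⟩
      continuous_toFun := ((G.continuous_ray v d₁).comp (by fun_prop)).subtype_mk _
      source' := Subtype.ext (by simpa using hd₁.ray_zero)
      target' := Subtype.ext (by simp) }
  let γ₂ : Path (⟨_, hUK hp₁⟩ : K) ⟨_, hUK hp₂⟩ :=
    { toFun := fun t => ⟨γ t, hUK (hγ t)⟩
      continuous_toFun := γ.continuous.subtype_mk _
      source' := Subtype.ext γ.source
      target' := Subtype.ext γ.target }
  let γ₃ : Path (⟨v, hvK⟩ : K) ⟨_, hUK hp₂⟩ :=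
    { toFun := fun t => ⟨G.ray v d₂ (δ * t), hmem d₂ hd₂ (fun s h h' => (hδ' s h h').2.2) _
        (mul_nonneg hδ.le t.2.1) (mul_le_of_le_one_right hδ.le t.2.2)⟩
      continuous_toFun := ((G.continuous_ray v d₂).comp (by fun_prop)).subtype_mk _
      source' := Subtype.ext (by simpa using hd₂.ray_zero)
      target' := Subtype.ext (by simp) }
  -- The loop leaves `v` along `d₁`, crosses `U`, and returns along `d₂`. Its lift climbs from `0`
  -- to `1`, then follows `1 + ℓ` from `1` back to `1`, then stays constant: the total increment is
  -- `1`.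
  let Γ₁ : Path (0 : ℝ) 1 :=
    { toFun := fun t => ramp δ (δ * t)
      continuous_toFun := (continuous_ramp δ).comp (by fun_prop)
      source' := ramp_of_le hδ (by simp)
      target' := ramp_of_ge hδ (by simp) }
  let Γ₂ : Path (1 : ℝ) 1 :=
    { toFun := fun t => 1 + ℓ (γ t)
      continuous_toFun := continuous_const.add (hℓc.comp_continuous γ.continuous hγ)
      source' := by rw [γ.source, (hray₁ δ hδ le_rfl).2, ramp_of_ge hδ le_rfl]; ring
      target' := by rw [γ.target, hray₂ δ hδ le_rfl]; ring }
  let θ : C(K, AddCircle (1 : ℝ)) := ⟨fun x => Θ x, hΘc.comp continuous_subtype_val⟩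
  have l₁ : ∀ t, (Γ₁ t : AddCircle (1 : ℝ)) = θ (γ₁ t) := by
    intro t
    change ((ramp δ (δ * t) : ℝ) : AddCircle (1 : ℝ)) = Θ (G.ray v d₁ (δ * t))
    rcases t.2.1.eq_or_lt with h | h
    · rw [← h, mul_zero, hd₁.ray_zero, hΘv, ramp_of_le hδ le_rfl]; rfl
    · rw [(hray₁ _ (mul_pos hδ h) (mul_le_of_le_one_right hδ.le t.2.2)).1]
  have l₂ : ∀ t, (Γ₂ t : AddCircle (1 : ℝ)) = θ (γ₂ t) := by
    intro t
    change ((1 + ℓ (γ t) : ℝ) : AddCircle (1 : ℝ)) = Θ (γ t)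
    rw [AddCircle.coe_add, AddCircle.coe_period, zero_add, hℓΘ]
  have l₃ : ∀ t, ((Path.refl (1 : ℝ)).symm t : AddCircle (1 : ℝ)) = θ (γ₃.symm t) := by
    intro t
    set t' := unitInterval.symm t
    refine (AddCircle.coe_period (1 : ℝ)).trans ?_
    change 0 = Θ (G.ray v d₂ (δ * t'))
    rcases t'.2.1.eq_or_lt with h | h
    · rw [← h, mul_zero, hd₂.ray_zero, hΘv]
    · rw [← hℓΘ, hray₂ _ (mul_pos hδ h) (mul_le_of_le_one_right hδ.le t'.2.2)]; rfl
  have l := Path.lift_trans l₁ (Path.lift_trans l₂ l₃)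
  refine firstBetti_ne_zero_of_loop θ (γ₁.trans (γ₂.trans γ₃.symm)).toContinuousMap
    ?_ (Γ₁.trans (Γ₂.trans (Path.refl (1 : ℝ)).symm)).toContinuousMap l ?_
  · exact (Path.source _).trans (Path.target _).symm
  · intro h
    exact zero_ne_one (α := ℝ) ((Path.source _).symm.trans (h.trans (Path.target _)))

end WeightedGraph

/-! ### Components of the complement of a support, the maximum principle, and firing. -/

/-- The fold is the distance to `T` truncated at `ε`. Off `T` it is locally a minimum of affine
functions with integer slopes, hence concave. -/
theorem exists_slopes_fold_min (ε : ℝ) (T : Finset ℝ) : ∀ t ∉ T, ∃ r l : ℤ, r + l ≤ 0 ∧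
    (∀ᶠ u in 𝓝[>] (0 : ℝ), T.fold min ε (fun s => |t + u - s|) =
      T.fold min ε (fun s => |t - s|) + r * u) ∧
    ∀ᶠ u in 𝓝[>] (0 : ℝ), T.fold min ε (fun s => |t - u - s|) =
      T.fold min ε (fun s => |t - s|) + l * u := by
  classical
  have habs : ∀ t s : ℝ, t ≠ s → ∃ r : ℤ, (∀ᶠ u in 𝓝[>] (0 : ℝ), |t + u - s| = |t - s| + r * u) ∧
      ∀ᶠ u in 𝓝[>] (0 : ℝ), |t - u - s| = |t - s| + (-r : ℤ) * u := by
    intro t s hts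
    rcases lt_or_gt_of_ne hts with h | h
    · refine ⟨-1, ?_, ?_⟩ <;> refine eventually_nhdsGT_zero_iff.2 ⟨s - t, by linarith,
        fun u h0 h1 => ?_⟩
      · rw [abs_of_neg (by linarith), abs_of_neg (by linarith)]; push_cast; ring
      · rw [abs_of_neg (by linarith), abs_of_neg (by linarith)]; push_cast; ring
    · refine ⟨1, ?_, ?_⟩ <;> refine eventually_nhdsGT_zero_iff.2 ⟨t - s, by linarith,
        fun u h0 h1 => ?_⟩
      · rw [abs_of_pos (by linarith), abs_of_pos (by linarith)]; push_cast; ring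
      · rw [abs_of_pos (by linarith), abs_of_pos (by linarith)]; push_cast; ring
  have hmin : ∀ {φ χ : ℝ → ℝ} {a b : ℝ} {m n : ℤ}, (∀ᶠ u in 𝓝[>] (0 : ℝ), φ u = a + m * u) →
      (∀ᶠ u in 𝓝[>] (0 : ℝ), χ u = b + n * u) →
      ∀ᶠ u in 𝓝[>] (0 : ℝ), min (φ u) (χ u) =
        min a b + ((if a < b then m else if b < a then n else min m n : ℤ) : ℝ) * u := by
    intro φ χ a b m n hφ hχ
    have hlim : ∀ (c : ℝ) (k : ℤ), Tendsto (fun u : ℝ => c + k * u) (𝓝[>] 0) (𝓝 c) := by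
      intro c k
      have : Tendsto (fun u : ℝ => c + k * u) (𝓝 0) (𝓝 (c + k * 0)) :=
        Continuous.tendsto (by fun_prop) 0
      rw [mul_zero, add_zero] at this
      exact this.mono_left nhdsWithin_le_nhds
    rcases lt_trichotomy a b with h | rfl | h
    · filter_upwards [hφ, hχ, (hlim a m).eventually_lt (hlim b n) h] with u h1 h2 h3
      rw [h1, h2, min_eq_left h3.le, min_eq_left h.le, if_pos h]
    · filter_upwards [hφ, hχ, self_mem_nhdsWithin] with u h1 h2 (h3 : 0 < u)
      rw [h1, h2, min_self, if_neg (lt_irrefl _), if_neg (lt_irrefl _), min_add_add_left,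
        Int.cast_min, min_mul_of_nonneg _ _ h3.le]
    · filter_upwards [hφ, hχ, (hlim b n).eventually_lt (hlim a m) h] with u h1 h2 h3
      rw [h1, h2, min_eq_right h3.le, min_eq_right h.le, if_neg (lt_asymm h), if_pos h]
  induction T using Finset.induction_on with
  | empty => exact fun t _ => ⟨0, 0, by simp, by simp, by simp⟩
  | insert s T hs ih =>
    intro t ht
    obtain ⟨r, l, hrl, hr, hl⟩ := ih t fun h => ht (Finset.mem_insert_of_mem h)
    obtain ⟨k, hk, hk'⟩ := habs t s fun h => ht (h ▸ Finset.mem_insert_self _ _)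
    simp only [Finset.fold_insert hs]
    refine ⟨_, _, ?_, hmin hk hr, hmin hk' hl⟩
    split_ifs <;> omega

namespace WeightedGraph

variable {V E : Type u} {G : WeightedGraph V E}

theorem finite_edge_params (S : Finset G.Point) (e : E) :
    {t | t ∈ Icc 0 (G.len e) ∧ G.edge e t ∈ S}.Finite := by
  have : {t | t ∈ Icc 0 (G.len e) ∧ G.edge e t ∈ S} ⊆
      ⋃ y ∈ S, {t | t ∈ Icc 0 (G.len e) ∧ G.edge e t = y} := by
    rintro t ⟨h, h'⟩
    exact mem_biUnion h' ⟨h, rfl⟩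
  refine (S.finite_toSet.biUnion fun y _ => ?_).subset this
  rcases y with v | ⟨e', t⟩
  · refine (Set.toFinite {0, G.len e}).subset ?_
    rintro s ⟨hs, h⟩
    by_contra hcon
    simp only [mem_insert_iff, mem_singleton_iff, not_or] at hcon
    rw [edge_of_mem G ⟨hs.1.lt_of_ne (Ne.symm hcon.1), hs.2.lt_of_ne hcon.2⟩] at h
    cases h
  · refine (Set.toFinite {(t : ℝ)}).subset ?_
    rintro s ⟨hs, h⟩
    rcases hs.1.eq_or_lt with h0 | h0
    · rw [edge_of_nonpos G h0.ge] at h; cases h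
    rcases hs.2.eq_or_lt with h1 | h1
    · rw [edge_of_len_le G h1.ge] at h; cases h
    · rw [edge_of_mem G ⟨h0, h1⟩] at h
      simp only [Point.inner.injEq] at h
      obtain ⟨rfl, h⟩ := h
      exact congrArg Subtype.val (eq_of_heq h)

theorem IsDir.start_mem_Icc {x : G.Point} {d : E × Bool} (hd : G.IsDir x d) :
    G.start x d ∈ Icc 0 (G.len d.1) := by
  obtain ⟨e, b⟩ := d
  rcases x with v | ⟨e', t⟩
  · cases b <;> simp [start, (G.len_pos e).le]
  · simp only [IsDir] at hd
    subst hd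
    exact Ioo_subset_Icc_self t.2

/-- A short initial segment without its origin is connected and misses the finite set `S`, so a
component of the complement of `S` contains all of it or none. -/
theorem eventually_ray_mem_or {S U : Set G.Point} {p : G.Point} (hS : S.Finite)
    (hU : U = connectedComponentIn Sᶜ p) {x : G.Point} {d : E × Bool} (hd : G.IsDir x d) :
    (∀ᶠ s in 𝓝[>] (0 : ℝ), G.ray x d s ∈ U) ∨ ∀ᶠ s in 𝓝[>] (0 : ℝ), G.ray x d s ∉ U := by
  have : ∀ᶠ s in 𝓝[>] (0 : ℝ), ∀ y ∈ S, G.ray x d s ≠ y :=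
    hS.eventually_all.2 fun y _ => hd.eventually_ne y
  obtain ⟨δ, hδ, h⟩ := eventually_nhdsGT_zero_iff.1 this
  have hsub : G.ray x d '' Ioo 0 δ ⊆ Sᶜ := by
    rintro _ ⟨s, hs, rfl⟩ hmem
    exact h s hs.1 hs.2 _ hmem rfl
  have hpre : IsPreconnected (G.ray x d '' Ioo 0 δ) :=
    isPreconnected_Ioo.image _ (G.continuous_ray x d).continuousOn
  by_cases hmeet : ∃ s ∈ Ioo 0 δ, G.ray x d s ∈ U
  · obtain ⟨s, hs, hsU⟩ := hmeet
    left
    refine eventually_nhdsGT_zero_iff.2 ⟨δ, hδ, fun u h0 h1 => ?_⟩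
    rw [hU] at hsU ⊢
    rw [connectedComponentIn_eq hsU]
    exact hpre.subset_connectedComponentIn ⟨s, hs, rfl⟩ hsub ⟨u, ⟨h0, h1⟩, rfl⟩
  · push Not at hmeet
    right
    exact eventually_nhdsGT_zero_iff.2 ⟨δ, hδ, fun u h0 h1 => hmeet u ⟨h0, h1⟩⟩

theorem mem_closure_of_eventually_ray {U : Set G.Point} {x : G.Point} {d : E × Bool}
    (hd : G.IsDir x d) (h : ∀ᶠ s in 𝓝[>] (0 : ℝ), G.ray x d s ∈ U) : x ∈ closure U := by
  have : Tendsto (G.ray x d) (𝓝[>] 0) (𝓝 x) := by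
    have := (G.continuous_ray x d).tendsto 0
    rw [hd.ray_zero] at this
    exact this.mono_left nhdsWithin_le_nhds
  exact mem_closure_of_tendsto this h

/-- Adding a limit point to a connected set keeps it connected, so a limit point off `S` would
already belong to the component. -/
theorem mem_of_mem_closure_component {S : Set G.Point} {p v : G.Point} (hp : p ∈ Sᶜ)
    (hv : v ∈ closure (connectedComponentIn Sᶜ p)) (hvU : v ∉ connectedComponentIn Sᶜ p) :
    v ∈ S := by
  by_contra hvS
  have : IsPreconnected (insert v (connectedComponentIn Sᶜ p)) :=
    isPreconnected_connectedComponentIn.subset_closure (subset_insert _ _)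
      (insert_subset hv subset_closure)
  exact hvU (this.subset_connectedComponentIn (mem_insert_of_mem _ (mem_connectedComponentIn hp))
    (insert_subset hvS (connectedComponentIn_subset _ _)) (mem_insert _ _))

variable [Fintype E] {D : G.Divisor} {p : G.Point}

/-- The maximum principle: a section of a reduced divisor is constant on the component of `p` in
the complement of the support. -/
theorem IsSection.eq_zero_on_component
    (hmax : ∀ f, IsSection D f → f p = 0 → ∀ x, f x ≤ 0) (hp : D p = 0) {f : G.Point → ℝ}
    (hf : IsSection D f) (h0 : f p = 0) :
    ∀ x ∈ connectedComponentIn (D.support : Set G.Point)ᶜ p, f x = 0 := by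
  set U := connectedComponentIn (D.support : Set G.Point)ᶜ p with hU
  have hUo : IsOpen U := D.support.finite_toSet.isClosed.isOpen_compl.connectedComponentIn
  have hpU : p ∈ U := mem_connectedComponentIn (by simpa using hp)
  have hle := hmax f hf h0
  -- At a zero in `U` all slopes are `≤ 0` because `f ≤ 0`, and their sum is `≥ 0` because `D`
  -- vanishes there; so all slopes are zero and `f` vanishes nearby.
  have hZ : IsOpen {x ∈ U | f x = 0} := by
    refine isOpen_of_eventually_ray fun x hx d hd => ?_
    choose! m hm using hf.1 x
    have hm0 : ∀ d ∈ G.dirs x, (m d : ℝ) ≤ 0 := fun d hd =>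
      (hm d (G.mem_dirs.1 hd)).le_of_le (HasSlope.const 0) hx.2
        (Eventually.of_forall fun s => hle _).frequently
    have hDx : D x = 0 := by simpa using connectedComponentIn_subset _ _ hx.1
    have hsum := hf.2 x
    rw [hDx, Int.cast_zero, zero_add, ord_eq_sum hm] at hsum
    have hz := (Finset.sum_eq_zero_iff_of_nonpos hm0).1
      (le_antisymm (Finset.sum_nonpos hm0) hsum) d (G.mem_dirs.2 hd)
    filter_upwards [hd.eventually_mem hUo hx.1, hm d hd] with s h1 h2
    rw [hz, hx.2, zero_mul, add_zero] at h2
    exact ⟨h1, h2⟩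
  have hZ' : IsOpen (f ⁻¹' {0}ᶜ) := isClosed_singleton.isOpen_compl.preimage hf.1.continuous
  have := isPreconnected_connectedComponentIn.subset_left_of_subset_union hZ hZ'
    (disjoint_left.2 fun x hx hx' => hx' hx.2) (s := U)
    (fun x hx => (em (f x = 0)).imp (fun h => ⟨hx, h⟩) id) ⟨p, hpU, hpU, h0⟩
  exact fun x hx => (this hx).2

/-- If `U` is a proper component of the complement of the support of an effective divisor `D`, and
each point outside `U` has at most one direction into `U`, then firing the complement of `U`
yields a section of `D` that is not bounded by its value on `U`. -/
theorem exists_section_of_unique_dirs (hD : 0 ≤ D) (hp : D p = 0) {a : G.Point}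
    (ha : a ∉ connectedComponentIn (D.support : Set G.Point)ᶜ p)
    (huniq : ∀ v ∉ connectedComponentIn (D.support : Set G.Point)ᶜ p, ∀ d d', G.IsDir v d →
      G.IsDir v d' →
      (∀ᶠ s in 𝓝[>] (0 : ℝ), G.ray v d s ∈ connectedComponentIn (D.support : Set G.Point)ᶜ p) →
      (∀ᶠ s in 𝓝[>] (0 : ℝ), G.ray v d' s ∈ connectedComponentIn (D.support : Set G.Point)ᶜ p) →
      d = d') :
    ∃ f, IsSection D f ∧ f p = 0 ∧ 0 < f a := by
  classical
  set U := connectedComponentIn (D.support : Set G.Point)ᶜ p with hU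
  have hUo : IsOpen U := D.support.finite_toSet.isClosed.isOpen_compl.connectedComponentIn
  have hpS : p ∈ (D.support : Set G.Point)ᶜ := by simpa using hp
  have hpU : p ∈ U := mem_connectedComponentIn hpS
  have hUD : ∀ x ∈ U, x ∉ D.support := fun x hx => connectedComponentIn_subset _ _ hx
  let T : E → Finset ℝ := fun e => (finite_edge_params D.support e).toFinset
  have hT : ∀ e t, t ∈ T e ↔ t ∈ Icc 0 (G.len e) ∧ G.edge e t ∈ D.support := fun e t => by
    simp only [T, Set.Finite.mem_toFinset, mem_ofPred_eq]
  -- With `ε` below the distance from either end of an edge to the other support points on it, the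
  -- truncated distance is constant near each vertex in `U`.
  obtain ⟨ε, hε, hεT⟩ : ∃ ε > 0, ∀ e, ∀ s ∈ T e,
      (0 ≠ s → ε < |0 - s|) ∧ (G.len e ≠ s → ε < |G.len e - s|) := by
    have hev : ∀ c : ℝ, 0 < c → ∀ᶠ u in 𝓝[>] (0 : ℝ), u < c := fun c hc =>
      nhdsWithin_le_nhds (eventually_lt_nhds hc)
    have : ∀ᶠ ε in 𝓝[>] (0 : ℝ), ∀ e, ∀ s ∈ T e,
        (0 ≠ s → ε < |0 - s|) ∧ (G.len e ≠ s → ε < |G.len e - s|) := by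
      refine eventually_all.2 fun e => (Finset.eventually_all _).2 fun s _ => Eventually.and ?_ ?_
      · exact eventually_imp_distrib_left.2 fun h => hev _ (abs_pos.2 (sub_ne_zero.2 h))
      · exact eventually_imp_distrib_left.2 fun h => hev _ (abs_pos.2 (sub_ne_zero.2 h))
    obtain ⟨ε, h, h'⟩ := (this.and self_mem_nhdsWithin).exists
    exact ⟨ε, h', h⟩
  let ρ : E → ℝ → ℝ := fun e t => (T e).fold min ε fun s => |t - s|
  -- On `U`, the distance along the edge to the support, truncated at `ε`; zero elsewhere. Its
  -- negative is the firing function.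
  let ψ : G.Point → ℝ := fun x => if x ∈ U then
    (match x with
      | Point.vertex _ => ε
      | Point.inner e t => ρ e t) else 0
  have hψ0 : ∀ x, x ∉ U → ψ x = 0 := fun x hx => if_neg hx
  have hψv : ∀ v, Point.vertex v ∈ U → ψ (Point.vertex v) = ε := fun v hv => if_pos hv
  have hψi : ∀ e t, Point.inner e t ∈ U → ψ (Point.inner e t) = ρ e t := fun e t h => if_pos h
  have hψray : ∀ x (d : E × Bool), G.IsDir x d → (∀ᶠ s in 𝓝[>] (0 : ℝ), G.ray x d s ∈ U) →
      ∀ᶠ s in 𝓝[>] (0 : ℝ), ψ (G.ray x d s) = ρ d.1 (G.start x d + dirSign d.2 * s) := by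
    intro x d hd h
    filter_upwards [hd.eventually_mem_Ioo, h] with s hs hsU
    have hx : G.ray x d s = Point.inner d.1 ⟨_, hs⟩ := edge_of_mem G hs
    rw [hx] at hsU ⊢
    exact hψi _ _ hsU
  have hstart : ∀ x (d : E × Bool), Tendsto (fun s : ℝ => G.start x d + dirSign d.2 * s) (𝓝[>] 0)
      (𝓝 (G.start x d)) := by
    intro x d
    have : Tendsto (fun s : ℝ => G.start x d + dirSign d.2 * s) (𝓝 0)
      (𝓝 (G.start x d + dirSign d.2 * 0)) := Continuous.tendsto (by fun_prop) 0
    rw [mul_zero, add_zero] at this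
    exact this.mono_left nhdsWithin_le_nhds
  have hvertex : ∀ w, Point.vertex w ∈ U → ∀ d, G.IsDir (Point.vertex w) d →
      HasSlope ψ (Point.vertex w) d (0 : ℤ) := by
    intro w hw d hd
    have h1 : ∀ᶠ s in 𝓝[>] (0 : ℝ), ∀ t ∈ T d.1,
        ε ≤ |G.start (Point.vertex w) d + dirSign d.2 * s - t| := by
      refine (Finset.eventually_all _).2 fun t ht => ?_
      have hne : G.start (Point.vertex w) d ≠ t := by
        rintro rfl
        have := ((hT _ _).1 ht).2
        rw [hd.edge_start] at this
        exact hUD _ hw this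
      have hlt : ε < |G.start (Point.vertex w) d - t| := by
        obtain ⟨e, b⟩ := d
        cases b
        · exact (hεT e t ht).2 hne
        · exact (hεT e t ht).1 hne
      have := (continuous_abs.tendsto _).comp ((hstart (Point.vertex w) d).sub_const t)
      exact (this.eventually_const_lt hlt).mono fun s hs => hs.le
    filter_upwards [hψray _ d hd (hd.eventually_mem hUo hw), h1] with s h2 h3
    rw [h2, hψv w hw, Int.cast_zero, zero_mul, add_zero]
    exact le_antisymm ((Finset.fold_min_le _).2 (Or.inl le_rfl))
      ((Finset.le_fold_min _).2 ⟨le_rfl, h3⟩)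
  have hinner : ∀ e t, Point.inner e t ∈ U → ∃ n : E × Bool → ℤ, n (e, true) + n (e, false) ≤ 0 ∧
      ∀ d, G.IsDir (Point.inner e t) d → HasSlope ψ (Point.inner e t) d (n d) := by
    intro e t ht
    have htT : (t : ℝ) ∉ T e := by
      rw [hT]
      rintro ⟨-, h⟩
      rw [edge_of_mem G t.2] at h
      exact hUD _ ht h
    obtain ⟨r, l, hrl, hr, hl⟩ := exists_slopes_fold_min ε (T e) t htT
    refine ⟨fun d => if d.2 then r else l, by simpa using hrl, ?_⟩
    rintro ⟨e', b⟩ hd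
    obtain rfl : e = e' := Eq.symm hd
    cases b
    · filter_upwards [hψray _ _ hd (hd.eventually_mem hUo ht), hl] with s h1 h2
      rw [h1, hψi _ _ ht]
      simpa [ρ, start, dirSign, sub_eq_add_neg] using h2
    · filter_upwards [hψray _ _ hd (hd.eventually_mem hUo ht), hr] with s h1 h2
      rw [h1, hψi _ _ ht]
      simpa [ρ, start, dirSign] using h2
  have hout0 : ∀ v ∉ U, ∀ d, (∀ᶠ s in 𝓝[>] (0 : ℝ), G.ray v d s ∉ U) →
      HasSlope ψ v d (0 : ℤ) := by
    intro v hv d h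
    filter_upwards [h] with s hs
    rw [hψ0 _ hs, hψ0 _ hv]; simp
  have hbdry : ∀ v ∉ U, ∀ d, G.IsDir v d → (∀ᶠ s in 𝓝[>] (0 : ℝ), G.ray v d s ∈ U) →
      v ∈ D.support := fun v hv d hd h =>
    mem_of_mem_closure_component hpS (mem_closure_of_eventually_ray hd h) hv
  have hout1 : ∀ v ∉ U, ∀ d, G.IsDir v d → (∀ᶠ s in 𝓝[>] (0 : ℝ), G.ray v d s ∈ U) →
      HasSlope ψ v d (1 : ℤ) := by
    intro v hv d hd h
    have hvT : G.start v d ∈ T d.1 := by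
      rw [hT, hd.edge_start]
      exact ⟨hd.start_mem_Icc, hbdry v hv d hd h⟩
    have hσ : ∀ s, 0 < s → |dirSign d.2 * s| = s := by
      intro s hs
      cases d.2 <;> simp [dirSign, abs_of_pos hs]
    have h1 : ∀ᶠ s in 𝓝[>] (0 : ℝ), ∀ t ∈ T d.1,
        s ≤ |G.start v d + dirSign d.2 * s - t| := by
      refine (Finset.eventually_all _).2 fun t ht => ?_
      by_cases hne : G.start v d = t
      · filter_upwards [self_mem_nhdsWithin] with s (hs : 0 < s)
        rw [hne, add_sub_cancel_left, hσ s hs]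
      · have h0 : 0 < |G.start v d - t| := abs_pos.2 (sub_ne_zero.2 hne)
        have := (continuous_abs.tendsto _).comp ((hstart v d).sub_const t)
        have hid : Tendsto (fun s : ℝ => s) (𝓝[>] 0) (𝓝 0) := nhdsWithin_le_nhds
        exact (hid.eventually_lt this h0).mono fun s hs => hs.le
    have hεs : ∀ᶠ s in 𝓝[>] (0 : ℝ), s < ε := nhdsWithin_le_nhds (eventually_lt_nhds hε)
    filter_upwards [hψray v d hd h, h1, hεs, self_mem_nhdsWithin] with s h2 h3 h4 (h5 : 0 < s)
    rw [h2, hψ0 v hv, Int.cast_one, one_mul, zero_add]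
    refine le_antisymm ((Finset.fold_min_le _).2 (Or.inr ⟨_, hvT, ?_⟩))
      ((Finset.le_fold_min _).2 ⟨h4.le, h3⟩)
    rw [add_sub_cancel_left, hσ s h5]
  -- Inside `U` the slopes of `ψ` have sum at most zero. Outside, they count the directions into
  -- `U`: at most one by `huniq`, and if there is one the point carries a chip of `D`.
  have hlocal : ∀ x, ∃ n : E × Bool → ℤ, (∀ d, G.IsDir x d → HasSlope ψ x d (n d)) ∧
      ∑ d ∈ G.dirs x, n d ≤ D x := by
    intro x
    have hDx := hD x
    rw [Finsupp.coe_zero, Pi.zero_apply] at hDx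
    by_cases hx : x ∈ U
    · rcases x with w | ⟨e, t⟩
      · exact ⟨fun _ => 0, hvertex w hx, by simpa using hDx⟩
      · obtain ⟨n, hn, h⟩ := hinner e t hx
        refine ⟨n, h, ?_⟩
        rw [dirs, Finset.sum_filter, Fintype.sum_prod_type,
          Finset.sum_eq_single e (fun b _ hb => by simp [IsDir, hb]) (by simp), Fintype.sum_bool]
        simp only [IsDir, if_true]
        exact hn.trans hDx
    · refine ⟨fun d => if ∀ᶠ s in 𝓝[>] (0 : ℝ), G.ray x d s ∈ U then 1 else 0, ?_, ?_⟩
      · intro d hd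
        by_cases h : ∀ᶠ s in 𝓝[>] (0 : ℝ), G.ray x d s ∈ U
        · simp only [if_pos h]
          exact hout1 x hx d hd h
        · simp only [if_neg h]
          exact hout0 x hx d
            ((eventually_ray_mem_or D.support.finite_toSet hU hd).resolve_left h)
      · by_cases hex : ∃ d, G.IsDir x d ∧ ∀ᶠ s in 𝓝[>] (0 : ℝ), G.ray x d s ∈ U
        · obtain ⟨d, hd, h⟩ := hex
          rw [Finset.sum_eq_single d (fun d' hd' hne => if_neg fun h' =>
            hne (huniq x hx d' d (G.mem_dirs.1 hd') hd h' h))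
            (fun h' => absurd (G.mem_dirs.2 hd) h'), if_pos h]
          have := Finsupp.mem_support_iff.1 (hbdry x hx d hd h)
          omega
        · rw [Finset.sum_eq_zero fun d hd => if_neg fun h => hex ⟨d, G.mem_dirs.1 hd, h⟩]
          exact hDx
  have hψaff : IsLocAffine ψ := fun x d hd => by
    obtain ⟨n, hn, -⟩ := hlocal x
    exact ⟨n d, hn d hd⟩
  have hsec : IsSection D (fun x => -ψ x) := ⟨hψaff.neg, fun x => by
    obtain ⟨n, hn, h⟩ := hlocal x
    rw [hψaff.ord_neg, ord_eq_sum hn]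
    have : ((∑ d ∈ G.dirs x, n d : ℤ) : ℝ) ≤ D x := by exact_mod_cast h
    push_cast at this
    linarith⟩
  have hpos : 0 < ψ p := by
    rcases p with w | ⟨e, t⟩
    · rw [hψv w hpU]; exact hε
    · rw [hψi e t hpU]
      refine (Finset.lt_fold_min _).2 ⟨hε, fun s hs => abs_pos.2 (sub_ne_zero.2 ?_)⟩
      rintro rfl
      have := ((hT _ _).1 hs).2
      rw [edge_of_mem G t.2] at this
      exact hUD _ hpU this
  exact ⟨_, hsec.add_const (ψ p), by simp, by simpa [hψ0 a ha] using hpos⟩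

/-! ### The contradiction with reducedness, and the theorem. -/

variable [Fintype V]

/-- If all `|D - a|` with `a ∈ A` are nonempty, then all `|D - p|` are, provided that `A` is
nonempty and the pieces of the cut along `A` have genus zero. -/
theorem linearSystem_sub_nonempty [ConnectedSpace G.Point] {A : Set G.Point} (hA : A.Nonempty)
    (hgenus : ∀ C ∈ cutComponents A, firstBetti (closure C) = 0)
    (h : ∀ a ∈ A, (G.linearSystem (D - Finsupp.single a 1)).Nonempty) (p : G.Point) :
    (G.linearSystem (D - Finsupp.single p 1)).Nonempty := by
  classical
  obtain ⟨a₀, ha₀⟩ := hA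
  have hDne : (G.linearSystem D).Nonempty :=
    linearSystem_nonempty_of_le (sub_le_self _ (Finsupp.single_nonneg.2 zero_le_one)) (h a₀ ha₀)
  obtain ⟨D', hD', htrans, hmax⟩ := exists_reduced_divisor hDne p
  by_contra hcon
  rw [htrans] at hcon
  have hp : D' p = 0 := by
    by_contra hp
    refine hcon (linearSystem_nonempty_iff.2 ⟨_, IsLocAffine.const 0, fun x => ?_⟩)
    rw [ord_const, add_zero, Finsupp.sub_apply, Finsupp.single_apply]
    have h1 := hD' p
    have h2 := hD' x
    rw [Finsupp.coe_zero, Pi.zero_apply] at h1 h2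
    norm_cast
    split_ifs with hx
    · subst hx; omega
    · simpa using h2
  set U := connectedComponentIn (D'.support : Set G.Point)ᶜ p with hU
  have hpS : p ∈ (D'.support : Set G.Point)ᶜ := by simpa using hp
  have hpU : p ∈ U := mem_connectedComponentIn hpS
  have hUo : IsOpen U := D'.support.finite_toSet.isClosed.isOpen_compl.connectedComponentIn
  -- A section for `D' - a` is one for `D'`, hence constant on `U`; for `a` in `U` its order at `a`
  -- is zero, and the coefficient `-1` remains.
  have hUA : ∀ a ∈ A, a ∉ U := by
    intro a ha haU
    obtain ⟨f, hf, hfD⟩ := linearSystem_nonempty_iff.1 ((htrans _).1 (h a ha))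
    have hs : IsSection D' f := ⟨hf, fun x => (hfD x).trans (by
      gcongr
      rw [Finsupp.sub_apply, Finsupp.single_apply]
      split_ifs <;> simp)⟩
    have hz := (hs.add_const (-f p)).eq_zero_on_component hmax hp (by simp)
    have hord : G.ord f a = 0 := by
      rw [ord_eq_sum (m := fun _ => 0) fun d hd => ?_]
      · simp
      · filter_upwards [hd.eventually_mem hUo haU] with s hs
        have h1 := hz _ hs
        have h2 := hz _ haU
        linarith
    have h1 := hfD a
    have h2 : D' a = 0 := by simpa using connectedComponentIn_subset _ _ haU
    rw [hord, Finsupp.sub_apply, h2, Finsupp.single_eq_same] at h1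
    norm_num at h1
  have hUA' : U ⊆ Aᶜ := fun x hx hxA => hUA x hxA hx
  have hUC : U ⊆ connectedComponentIn Aᶜ p :=
    isPreconnected_connectedComponentIn.subset_connectedComponentIn hpU hUA'
  obtain ⟨f, hf, hf0, hfa⟩ := exists_section_of_unique_dirs hD' hp (hUA a₀ ha₀)
    fun v hv d d' hd hd' hin hin' => by
      by_contra hne
      -- The loop lies in `U` and its boundary point `v`, hence in the closure of the piece that
      -- contains `U`.
      exact firstBetti_ne_zero_of_two_dirs hUo ⟨⟨p, hpU⟩, isPreconnected_connectedComponentIn⟩ hv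
        (hUC.trans subset_closure) (closure_mono hUC (mem_closure_of_eventually_ray hd hin)) hne
        hd hd' hin hin' (hgenus _ ⟨p, hUA' hpU, rfl⟩)
  exact absurd (hmax f hf hf0 a₀) (not_le.2 hfa)

end WeightedGraph

end

theorem theorem18 {V E : Type u} [Fintype V] [Fintype E] (G : WeightedGraph V E)
    [ConnectedSpace G.Point] (A : Set G.Point)
    (hpieces : (cutComponents A).Nontrivial)
    (hgenus : ∀ C ∈ cutComponents A, firstBetti (closure C) = 0) :
    G.IsRankDetermining A := by
  refine WeightedGraph.isRankDetermining_of_forall fun D h p =>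
    WeightedGraph.linearSystem_sub_nonempty ?_ hgenus h p
  rw [Set.nonempty_iff_ne_empty]
  rintro rfl
  -- Two distinct pieces are needed to know that `A` is nonempty: cutting the connected graph along
  -- the empty set leaves a single piece.
  obtain ⟨C, ⟨x, -, rfl⟩, C', ⟨y, -, rfl⟩, hne⟩ := hpieces
  refine hne ?_
  rw [Set.compl_empty, connectedComponentIn_univ, connectedComponentIn_univ,
    PreconnectedSpace.connectedComponent_eq_univ, PreconnectedSpace.connectedComponent_eq_univ]
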